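/- A one-clock timed automaton (1-TA) over a finite alphabet $\Sigma$ is a tuple $\mathcal A=(Q,q_I,T,F)$ with a finite set of states $Q$, an initial state $q_I$, final states $F\subseteq Q$, and a finite set $T$ of transitions $(q,q',a,\phi,r)$, where $a\in\Sigma$, $r\in\{0,1\}$, and the guard $\phi$ is a non-empty finite conjunction of constraints $c<x$, $x=c$, $x<c$ with $c\in\mathbb N$, defining a set $[\![\phi]\!]\subseteq\mathbb R_{\ge0}$. A timed word is a finite sequence $(t_1\cdot a_1)\cdots(t_n\cdot a_n)$ with $t_i\in\mathbb R_{\ge 0}$ and $a_i\in\Sigma$. From a configuration $(q,\nu)$, reading $(t\cdot a)$, a transition $(q,q',a,\phi,r)$ with $\nu+t\in[\![\phi]\!]$ leads to $(q',r(\nu+t))$; runs start in $(q_I,0)$, and $\mathcal L(\mathcal A)$ is the set of timed words with a run ending in a state of $F$. $\mathcal A$ is deterministic (a 1-DTA) if distinct transitions with the same source and the same letter have guards defining disjoint sets, and complete if moreover every timed word has exactly one run. Its (maximum) constant is the largest constant occurring in its guards ($0$ if there is none). For $K\in\mathbb N$, the $K$-regions are the sets $\{c\}$ ($0\le c\le K$),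 $(c,c+1)$ ($0\le c<K$) and $(K,\infty)$. A complete 1-DTA $\mathcal A$ induces the reset function $R^{\mathcal A}$ that maps each timed word $u$ to the clock value after reading $u$. A timed language is 1-DTA recognizable if it is $\mathcal L(\mathcal A)$ for some 1-DTA $\mathcal A$. For a timed language $L$ put $u^{-1}L=\{w\mid uw\in L\}$, and define its syntactic reset function $\mathbf R^L$ inductively by $\mathbf R^L(\varepsilon)=0$ and $$\mathbf R^L(u(t\cdot a))=\begin{cases}0&\text{if }(u(t\cdot a))^{-1}L\text{ is 1-DTA recognizable},\\ \mathbf R^L(u)+t&\text{otherwise.}\end{cases}$$ Theorem. Let $\Sigma$ be a finite alphabet. 1. There is a computable function that maps every 1-DTA $\mathcal A$ over $\Sigma$, with language $L$ and maximum constant $K$, to a complete 1-DTA $\mathcal B$ over $\Sigma$ with $\mathcal L(\mathcal B)=L$, with the same maximum constant $K$, all of whose guards define $K$-regions, and which induces the syntactic reset function: $R^{\mathcal B}=\mathbf R^L$. 2. If $L$ is a 1-DTA recognizable timed language over $\Sigma$, then $\mathbf R^L(u)\in[0,K_L]\setminus\mathbb N_{>0}$ for every timed word $u$, where $K_L$ is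 the smallest $K\in\mathbb N$ such that some 1-DTA with maximum constant $K$ accepts $L$. -/

import Mathlib

open scoped NNReal

namespace OneClock

universe u

/-- Timed words over `α`: finite sequences of pairs (delay, letter). -/
abbrev TimedWord (α : Type u) := List (ℝ≥0 × α)

/-- Residual language `u⁻¹L`. -/
def residual {α : Type u} (L : Set (TimedWord α)) (u : TimedWord α) : Set (TimedWord α) :=
  {w | u ++ w ∈ L}

/-- Atomic clock constraints: `c < x`, `x = c`, `x < c` with `c` a natural number. -/
inductive Atom where
  | gt (c : ℕ)
  | eq (c : ℕ)
  | lt (c : ℕ)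

/-- The constant occurring in an atomic constraint. -/
def Atom.const : Atom → ℕ
  | .gt c => c
  | .eq c => c
  | .lt c => c

/-- The clock values that satisfy an atomic constraint. -/
def Atom.denote : Atom → Set ℝ≥0
  | .gt c => {x | (c : ℝ≥0) < x}
  | .eq c => {x | x = (c : ℝ≥0)}
  | .lt c => {x | x < (c : ℝ≥0)}

/-- A clock constraint is a conjunction of one or more atomic constraints
(the first one, and the list of the others). -/
abbrev Guard := Atom × List Atom

/-- All atomic constraints of a clock constraint. -/
def Guard.atoms (g : Guard) : List Atom := g.1 :: g.2

/-- The set of clock values that satisfy a clock constraint. -/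
def Guard.denote (g : Guard) : Set ℝ≥0 := {x | ∀ c ∈ Guard.atoms g, x ∈ c.denote}

/-- A transition from `src` to `tgt`; the clock is reset iff `reset = true`. -/
structure Transition (α : Type u) where
  src : ℕ
  tgt : ℕ
  letter : α
  guard : Guard
  reset : Bool

/-- The clock value after taking the transition with clock value `x`. -/
def Transition.update {α : Type u} (θ : Transition α) (x : ℝ≥0) : ℝ≥0 :=
  if θ.reset = true then 0 else x

/-- A one-clock timed automaton over `α`, as a finite object that algorithms can manipulate.
States are natural numbers; the (finite) state set consists of the states that occur in the
automaton. The lists `trans` and `final` enumerate the finite sets of transitions and of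
final states. -/
structure OneTA (α : Type u) where
  init : ℕ
  trans : List (Transition α)
  final : List ℕ

namespace OneTA

variable {α : Type u}

/-- `A.Run q ν w q' ν'`: there is a run of `A` on `w` from configuration `(q, ν)` to
configuration `(q', ν')`. -/
inductive Run (A : OneTA α) : ℕ → ℝ≥0 → TimedWord α → ℕ → ℝ≥0 → Prop
  | nil (q : ℕ) (ν : ℝ≥0) : Run A q ν [] q ν
  | cons (θ : Transition α) (q : ℕ) (ν t : ℝ≥0) (a : α) (w : TimedWord α) (q' : ℕ) (ν' : ℝ≥0)
      (mem : θ ∈ A.trans) (hsrc : θ.src = q) (hletter : θ.letter = a)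
      (sat : ν + t ∈ Guard.denote θ.guard)
      (rest : Run A θ.tgt (θ.update (ν + t)) w q' ν') :
      Run A q ν ((t, a) :: w) q' ν'

/-- The language of `A`: the timed words with an accepting run from the initial
configuration. -/
def lang (A : OneTA α) : Set (TimedWord α) :=
  {w | ∃ q ∈ A.final, ∃ ν : ℝ≥0, A.Run A.init 0 w q ν}

/-- Determinism: distinct transitions with the same source and the same letter have disjoint
guards. -/
def Deterministic (A : OneTA α) : Prop :=
  ∀ θ ∈ A.trans, ∀ θ' ∈ A.trans, θ ≠ θ' →
    θ.src ≠ θ'.src ∨ θ.letter ≠ θ'.letter ∨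
      Guard.denote θ.guard ∩ Guard.denote θ'.guard = ∅

/-- Every timed word has a run from the initial configuration (for a deterministic automaton
it then has exactly one). -/
def Complete (A : OneTA α) : Prop :=
  ∀ w : TimedWord α, ∃ (q : ℕ) (ν : ℝ≥0), A.Run A.init 0 w q ν

/-- All constants that occur in the guards of `A`. -/
def constants (A : OneTA α) : List ℕ :=
  A.trans.flatMap fun θ => (Guard.atoms θ.guard).map Atom.const

/-- The maximum constant of `A` (`0` if there are no transitions). -/
def maxConst (A : OneTA α) : ℕ := A.constants.foldr max 0

/-- `A` (deterministic and complete) induces the reset function `R`: after reading `u`, the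
clock of `A` has the value `R u`. -/
def Induces (A : OneTA α) (R : TimedWord α → ℝ≥0) : Prop :=
  ∀ u : TimedWord α, ∃ q : ℕ, A.Run A.init 0 u q (R u)

end OneTA

/-- The `K`-regions: `{c}` with `c ≤ K`, `(c, c + 1)` with `c < K`, and `(K, ∞)`. -/
def IsRegion (K : ℕ) (S : Set ℝ≥0) : Prop :=
  (∃ c : ℕ, c ≤ K ∧ S = {(c : ℝ≥0)}) ∨
  (∃ c : ℕ, c < K ∧ S = Set.Ioo (c : ℝ≥0) ((c : ℝ≥0) + 1)) ∨
  S = Set.Ioi (K : ℝ≥0)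

/-- Every guard of `A` defines a `K`-region, for `K` the maximum constant of `A`. -/
def OneTA.RegionGuarded {α : Type u} (A : OneTA α) : Prop :=
  ∀ θ ∈ A.trans, IsRegion A.maxConst (Guard.denote θ.guard)

/-- `L` is recognized by a one-clock deterministic timed automaton. -/
def Recognizable {α : Type u} (L : Set (TimedWord α)) : Prop :=
  ∃ A : OneTA α, A.Deterministic ∧ A.lang = L

/-- The smallest `K` such that some one-clock deterministic timed automaton with maximum
constant `K` accepts `L` (used only for recognizable `L`). -/
noncomputable def minConst {α : Type u} (L : Set (TimedWord α)) : ℕ :=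
  sInf {K : ℕ | ∃ A : OneTA α, A.Deterministic ∧ A.lang = L ∧ A.maxConst = K}

open Classical in
/-- Auxiliary recursion for the syntactic reset function: `y` is the current clock value and
`L` the current residual language. -/
noncomputable def synResetFrom {α : Type u} :
    Set (TimedWord α) → ℝ≥0 → TimedWord α → ℝ≥0
  | _, y, [] => y
  | L, y, p :: w =>
      synResetFrom (residual L [p]) (if Recognizable (residual L [p]) then 0 else y + p.1) w

/-- The syntactic reset function of `L`. -/
noncomputable def synReset {α : Type u} (L : Set (TimedWord α)) (u : TimedWord α) : ℝ≥0 :=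
  synResetFrom L 0 u

theorem synReset_nil {α : Type u} (L : Set (TimedWord α)) : synReset L [] = 0 := rfl

open Classical in
theorem synResetFrom_snoc {α : Type u} (u : TimedWord α) (t : ℝ≥0) (a : α) :
    ∀ (L : Set (TimedWord α)) (y : ℝ≥0), synResetFrom L y (u ++ [(t, a)]) =
      if Recognizable (residual L (u ++ [(t, a)])) then 0 else synResetFrom L y u + t := by
  induction u with
  | nil => intro L y; rfl
  | cons p u ih =>
    intro L y
    simp only [List.cons_append, synResetFrom]
    rw [ih]
    rfl

open Classical in
/-- The defining recursion of the syntactic reset function. -/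
theorem synReset_snoc {α : Type u} (L : Set (TimedWord α)) (u : TimedWord α) (t : ℝ≥0) (a : α) :
    synReset L (u ++ [(t, a)]) =
      if Recognizable (residual L (u ++ [(t, a)])) then 0 else synReset L u + t :=
  synResetFrom_snoc u t a L 0

/-! Codings of the finite objects above, so that computability of functions on automata makes
sense. -/

def Atom.equivSum : Atom ≃ ℕ ⊕ ℕ ⊕ ℕ where
  toFun
    | .gt c => Sum.inl c
    | .eq c => Sum.inr (Sum.inl c)
    | .lt c => Sum.inr (Sum.inr c)
  invFun
    | Sum.inl c => .gt c
    | Sum.inr (Sum.inl c) => .eq c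
    | Sum.inr (Sum.inr c) => .lt c
  left_inv a := by cases a <;> rfl
  right_inv s := by rcases s with c | c | c <;> rfl

instance : Primcodable Atom := Primcodable.ofEquiv _ Atom.equivSum

def Transition.equivProd (α : Type u) : Transition α ≃ ℕ × ℕ × α × Guard × Bool where
  toFun θ := (θ.src, θ.tgt, θ.letter, θ.guard, θ.reset)
  invFun p := ⟨p.1, p.2.1, p.2.2.1, p.2.2.2.1, p.2.2.2.2⟩
  left_inv _ := rfl
  right_inv _ := rfl

instance {α : Type u} [Primcodable α] : Primcodable (Transition α) :=
  Primcodable.ofEquiv _ (Transition.equivProd α)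

def OneTA.equivProd (α : Type u) : OneTA α ≃ ℕ × List (Transition α) × List ℕ where
  toFun A := (A.init, A.trans, A.final)
  invFun p := ⟨p.1, p.2.1, p.2.2⟩
  left_inv _ := rfl
  right_inv _ := rfl

instance {α : Type u} [Primcodable α] : Primcodable (OneTA α) :=
  Primcodable.ofEquiv _ (OneTA.equivProd α)

end OneClock

/-!
Two pairs of clock values lie in the same region when corresponding values lie in the same regions
and the differences lie in the same point or open interval of the integer grid. Such pairs stay in
a common region under suitable delays, so a deterministic automaton accepts the same words from
both values of one pair iff it does so from both values of the other. Within an open interval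
`(j, j + 1)` every case is therefore represented by `j + 1/4` and `j + 3/4`, and equality of the
languages accepted from these two values is decided by searching the finitely many pairs of
quarters, capped above the maximum constant.

The residual language after `u` is the language accepted from the configuration reached by `u`. It
is recognizable iff it does not change when the clock value moves within its region: a recognizer
reads the residual from clock value `0`, so it cannot notice a small shift of the value in `A`;
conversely a language that is constant on a region can be read from a point in it, hence by an
automaton that starts at an integer clock value.

The canonical automaton remembers the configuration of `A` up to region at its last reset, and
resets exactly when the language is constant on the current region.
-/

namespace OneClock

/-- Index of the region of a clock value: `2 * c` for the value `c`, and `2 * c + 1` for the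
values in the open interval `(c, c + 1)`. -/
noncomputable def regionIndex (x : ℝ≥0) : ℕ := ⌊x⌋₊ + ⌈x⌉₊

theorem two_mul_lt_regionIndex {c : ℕ} {x : ℝ≥0} : 2 * c < regionIndex x ↔ (c : ℝ≥0) < x := by
  have h₁ := Nat.floor_le_ceil x
  have h₂ := Nat.ceil_le_floor_add_one x
  rw [← Nat.lt_ceil, regionIndex]
  omega

theorem regionIndex_lt_two_mul {c : ℕ} {x : ℝ≥0} : regionIndex x < 2 * c ↔ x < (c : ℝ≥0) := by
  have h₁ := Nat.floor_le_ceil x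
  have h₂ := Nat.ceil_le_floor_add_one x
  rw [← Nat.floor_lt zero_le, regionIndex]
  omega

theorem regionIndex_eq_two_mul {c : ℕ} {x : ℝ≥0} : regionIndex x = 2 * c ↔ x = (c : ℝ≥0) := by
  rw [eq_iff_le_not_lt, eq_iff_le_not_lt, ← not_lt, ← not_lt, two_mul_lt_regionIndex,
    regionIndex_lt_two_mul]

theorem regionIndex_eq_two_mul_add_one {c : ℕ} {x : ℝ≥0} :
    regionIndex x = 2 * c + 1 ↔ (c : ℝ≥0) < x ∧ x < (c : ℝ≥0) + 1 := by
  rw [← Nat.cast_add_one, ← two_mul_lt_regionIndex, ← regionIndex_lt_two_mul]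
  omega

@[simp] theorem regionIndex_natCast (c : ℕ) : regionIndex (c : ℝ≥0) = 2 * c :=
  regionIndex_eq_two_mul.2 rfl

@[simp] theorem regionIndex_zero : regionIndex 0 = 0 := by simp [regionIndex]

theorem regionIndex_natCast_add (c : ℕ) (x : ℝ≥0) :
    regionIndex ((c : ℝ≥0) + x) = 2 * c + regionIndex x := by
  simp only [regionIndex, add_comm (c : ℝ≥0), Nat.floor_add_natCast zero_le,
    Nat.ceil_add_natCast zero_le]
  ring

/-- Truth of an atomic constraint in the region with index `r`. -/
def Atom.sat : Atom → ℕ → Bool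
  | .gt c, r => decide (2 * c < r)
  | .eq c, r => decide (r = 2 * c)
  | .lt c, r => decide (r < 2 * c)

theorem Atom.mem_denote_iff (c : Atom) (x : ℝ≥0) : x ∈ c.denote ↔ c.sat (regionIndex x) := by
  cases c <;> simp [Atom.denote, Atom.sat, two_mul_lt_regionIndex, regionIndex_lt_two_mul,
    regionIndex_eq_two_mul]

theorem Atom.sat_min {c : Atom} {K : ℕ} (h : c.const ≤ K) (r : ℕ) :
    c.sat (min r (2 * K + 1)) = c.sat r := by
  cases c <;> simp only [Atom.sat, Atom.const] at h ⊢ <;> congr 1 <;> apply propext <;> omega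

/-- Truth of a clock constraint in the region with index `r`. -/
def Guard.sat (g : Guard) (r : ℕ) : Bool := (Guard.atoms g).all fun c => c.sat r

theorem Guard.mem_denote_iff (g : Guard) (x : ℝ≥0) :
    x ∈ Guard.denote g ↔ Guard.sat g (regionIndex x) := by
  simp [Guard.denote, Guard.sat, Atom.mem_denote_iff]

/-- Effect on a clock value, or on its index, of a step that resets the clock iff `b = true`. -/
def resetIf {R : Type*} [Zero R] (b : Bool) (x : R) : R := bif b then 0 else x

@[simp] theorem resetIf_true {R : Type*} [Zero R] (x : R) : resetIf true x = 0 := rfl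

@[simp] theorem resetIf_false {R : Type*} [Zero R] (x : R) : resetIf false x = x := rfl

theorem Transition.update_eq_resetIf {α : Type*} (θ : Transition α) (x : ℝ≥0) :
    θ.update x = resetIf θ.reset x := by
  cases h : θ.reset <;> simp [update, h]

namespace OneTA

variable {α : Type*} {A A' : OneTA α}

theorem maxConst_le_iff {K : ℕ} :
    A.maxConst ≤ K ↔ ∀ θ ∈ A.trans, ∀ c ∈ Guard.atoms θ.guard, c.const ≤ K := by
  have hconst : (∀ n ∈ A.constants, n ≤ K) ↔
      ∀ θ ∈ A.trans, ∀ c ∈ Guard.atoms θ.guard, c.const ≤ K := by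
    simp only [constants, List.forall_mem_flatMap, List.forall_mem_map]
  rw [← hconst]
  exact ⟨fun h n hn => (List.le_max_of_le hn le_rfl).trans h, List.max_le_of_forall_le _ _⟩

theorem const_le_maxConst {θ : Transition α} (hθ : θ ∈ A.trans) {c : Atom}
    (hc : c ∈ Guard.atoms θ.guard) : c.const ≤ A.maxConst :=
  maxConst_le_iff.1 le_rfl θ hθ c hc

theorem guard_sat_min {θ : Transition α} (hθ : θ ∈ A.trans) (r : ℕ) :
    Guard.sat θ.guard (min r (2 * A.maxConst + 1)) = Guard.sat θ.guard r := by
  rw [Bool.eq_iff_iff]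
  simp only [Guard.sat, List.all_eq_true]
  exact forall₂_congr fun c hc => by rw [Atom.sat_min (const_le_maxConst hθ hc)]

theorem Deterministic.eq_of_mem_denote (hA : A.Deterministic) {θ θ' : Transition α}
    (hθ : θ ∈ A.trans) (hθ' : θ' ∈ A.trans) (hsrc : θ.src = θ'.src)
    (hletter : θ.letter = θ'.letter) {x : ℝ≥0} (hx : x ∈ Guard.denote θ.guard)
    (hx' : x ∈ Guard.denote θ'.guard) : θ = θ' := by
  by_contra hne
  rcases hA θ hθ θ' hθ' hne with h | h | h
  exacts [h hsrc, h hletter, Set.disjoint_iff_inter_eq_empty.2 h |>.le_bot ⟨hx, hx'⟩]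

theorem Induces.complete {R : TimedWord α → ℝ≥0} (h : A.Induces R) : A.Complete := fun w =>
  let ⟨q, hrun⟩ := h w
  ⟨q, R w, hrun⟩

/-- A configuration of an automaton completed by a sink: the state, which is `none` for the sink,
and the clock value. -/
abbrev Config := Option ℕ × ℝ≥0

/-- Acceptance by the empty word from a state of the automaton completed by a sink, where the sink
is `none` and the states of `A` are wrapped in `some`. -/
def Accepting (A : OneTA α) (q : Option ℕ) : Prop := ∃ f ∈ A.final, some f = q

instance (A : OneTA α) (q : Option ℕ) : Decidable (A.Accepting q) :=
  inferInstanceAs (Decidable (∃ f ∈ A.final, some f = q))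

/-- The states of the automaton completed by the sink `none`. -/
def states (A : OneTA α) : List (Option ℕ) :=
  none :: some A.init :: A.trans.map fun θ => some θ.tgt

theorem init_mem_states (A : OneTA α) : some A.init ∈ A.states := by simp [states]

variable [DecidableEq α]

/-- The first transition of `A` from state `q` with letter `a` that is enabled in the region with
index `r`. -/
def enabled (A : OneTA α) (q : Option ℕ) (a : α) (r : ℕ) : Option (Transition α) :=
  A.trans.find? fun θ => some θ.src = q ∧ θ.letter = a ∧ Guard.sat θ.guard r

/-- Target and reset of the step on letter `a` in the region with index `r`, in the automaton
completed by the sink `none`. -/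
def step (A : OneTA α) (q : Option ℕ) (a : α) (r : ℕ) : Option ℕ × Bool :=
  ((A.enabled q a r).map fun θ => (some θ.tgt, θ.reset)).getD (none, true)

/-- The configuration reached by reading a letter without delay. -/
noncomputable def read (A : OneTA α) (c : Config) (a : α) : Config :=
  ((A.step c.1 a (regionIndex c.2)).1, resetIf (A.step c.1 a (regionIndex c.2)).2 c.2)

/-- The configuration reached by letting time pass and then reading a letter. -/
noncomputable def timedRead (A : OneTA α) (c : Config) (p : ℝ≥0 × α) : Config :=
  A.read (c.1, c.2 + p.1) p.2

/-- The language accepted from a configuration of the completed automaton. -/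
def langFrom (A : OneTA α) (c : Config) : Set (TimedWord α) :=
  {w | A.Accepting (w.foldl A.timedRead c).1}

theorem step_min (A : OneTA α) (q : Option ℕ) (a : α) (r : ℕ) :
    A.step q a (min r (2 * A.maxConst + 1)) = A.step q a r := by
  suffices A.enabled q a (min r (2 * A.maxConst + 1)) = A.enabled q a r by rw [step, this, step]
  exact List.find?_congr fun θ hθ => by rw [guard_sat_min hθ]

theorem step_fst_mem_states (A : OneTA α) (q : Option ℕ) (a : α) (r : ℕ) :
    (A.step q a r).1 ∈ A.states := by
  rw [step]
  cases h : A.enabled q a r with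
  | none => exact List.mem_cons_self
  | some θ =>
    refine List.mem_cons_of_mem _ (List.mem_cons_of_mem _ ?_)
    exact List.mem_map.2 ⟨θ, List.mem_of_find?_eq_some h, rfl⟩

theorem Deterministic.enabled_eq_some_iff (hA : A.Deterministic) {q : ℕ} {a : α} {x : ℝ≥0}
    {θ : Transition α} : A.enabled (some q) a (regionIndex x) = some θ ↔
      θ ∈ A.trans ∧ θ.src = q ∧ θ.letter = a ∧ x ∈ Guard.denote θ.guard := by
  have spec : ∀ {θ' : Transition α}, A.enabled (some q) a (regionIndex x) = some θ' →
      θ' ∈ A.trans ∧ θ'.src = q ∧ θ'.letter = a ∧ x ∈ Guard.denote θ'.guard := fun h =>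
    ⟨List.mem_of_find?_eq_some h, by
      simpa [Guard.mem_denote_iff] using List.find?_some h⟩
  refine ⟨spec, fun ⟨hθ, hsrc, hletter, hx⟩ => ?_⟩
  cases h : A.enabled (some q) a (regionIndex x) with
  | none =>
    refine absurd (List.find?_eq_none.1 h θ hθ) ?_
    simpa [hsrc, hletter, ← Guard.mem_denote_iff] using hx
  | some θ' =>
    obtain ⟨hθ', hsrc', hletter', hx'⟩ := spec h
    rw [hA.eq_of_mem_denote hθ' hθ (hsrc'.trans hsrc.symm) (hletter'.trans hletter.symm) hx' hx]

@[simp] theorem step_none (A : OneTA α) (a : α) (r : ℕ) : A.step none a r = (none, true) := by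
  rw [step, enabled, List.find?_eq_none.2 (by simp), Option.map_none, Option.getD_none]

theorem foldl_timedRead_none (A : OneTA α) (w : TimedWord α) (x : ℝ≥0) :
    (w.foldl A.timedRead (none, x)).1 = none := by
  induction w generalizing x with
  | nil => rfl
  | cons p w ih => simpa [timedRead, read] using ih 0

theorem Deterministic.run_iff (hA : A.Deterministic) {q q' : ℕ} {x x' : ℝ≥0} {w : TimedWord α} :
    A.Run q x w q' x' ↔ w.foldl A.timedRead (some q, x) = (some q', x') := by
  induction w generalizing q x with
  | nil =>
    rw [List.foldl_nil, Prod.mk.injEq, Option.some.injEq]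
    exact ⟨fun h => by cases h; exact ⟨rfl, rfl⟩, fun ⟨h, h'⟩ => h ▸ h' ▸ .nil q x⟩
  | cons p w ih =>
    obtain ⟨t, a⟩ := p
    rw [List.foldl_cons]
    constructor
    · rintro (_ | ⟨θ, _, _, _, _, _, _, _, hθ, hsrc, hletter, hsat, hrest⟩)
      have hstep := hA.enabled_eq_some_iff.2 ⟨hθ, hsrc, hletter, hsat⟩
      rw [Transition.update_eq_resetIf] at hrest
      simpa [timedRead, read, step, hstep] using ih.1 hrest
    · intro h
      cases hstep : A.enabled (some q) a (regionIndex (x + t)) with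
      | none =>
        simp only [timedRead, read, step, hstep, Option.map_none, Option.getD_none] at h
        cases (A.foldl_timedRead_none w _).symm.trans (congrArg Prod.fst h)
      | some θ =>
        obtain ⟨hθ, hsrc, hletter, hsat⟩ := hA.enabled_eq_some_iff.1 hstep
        refine .cons θ q x t a w q' x' hθ hsrc hletter hsat (ih.2 ?_)
        simpa [Transition.update_eq_resetIf, timedRead, read, step, hstep] using h

theorem Deterministic.lang_eq_langFrom (hA : A.Deterministic) :
    A.lang = A.langFrom (some A.init, 0) := by
  ext w
  constructor
  · rintro ⟨q, hq, x, hrun⟩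
    exact ⟨q, hq, by rw [hA.run_iff.1 hrun]⟩
  · rintro ⟨q, hq, h⟩
    exact ⟨q, hq, _, hA.run_iff.2 (Prod.ext h.symm rfl)⟩

theorem residual_langFrom (A : OneTA α) (c : Config) (w : TimedWord α) :
    residual (A.langFrom c) w = A.langFrom (w.foldl A.timedRead c) := by
  ext v
  simp only [residual, langFrom, Set.mem_ofPred_eq, List.foldl_append]

theorem langFrom_read_congr {c c' : Config} (h : A.langFrom c = A'.langFrom c') (a : α) :
    A.langFrom (A.read c a) = A'.langFrom (A'.read c' a) := by
  simpa only [residual_langFrom, List.foldl_cons, List.foldl_nil, timedRead, add_zero] using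
    congrArg (residual · [(0, a)]) h

/-- The words of length `n` in `A.langFrom c`, as a means to compare two languages by induction on
the length of words while the words themselves are being changed. -/
def langAt (A : OneTA α) (n : ℕ) (c : Config) : Set (TimedWord α) :=
  {w | w ∈ A.langFrom c ∧ w.length = n}

theorem langFrom_eq_iff_langAt {c c' : Config} :
    A.langFrom c = A'.langFrom c' ↔ ∀ n, A.langAt n c = A'.langAt n c' := by
  refine ⟨fun h n => by rw [langAt, h, langAt], fun h => Set.ext fun w => ?_⟩
  simpa [langAt] using Set.ext_iff.1 (h w.length) w

theorem langAt_zero_eq_iff {c c' : Config} :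
    A.langAt 0 c = A'.langAt 0 c' ↔ (A.Accepting c.1 ↔ A'.Accepting c'.1) := by
  simp [langAt, Set.ext_iff, langFrom]

theorem langAt_succ_eq_iff {c c' : Config} {n : ℕ} :
    A.langAt (n + 1) c = A'.langAt (n + 1) c' ↔
      ∀ p, A.langAt n (A.timedRead c p) = A'.langAt n (A'.timedRead c' p) := by
  simp only [langAt, langFrom, Set.ext_iff, Set.mem_ofPred_eq]
  refine ⟨fun h p w => by simpa using h (p :: w), fun h w => ?_⟩
  cases w with
  | nil => simp
  | cons p w => simpa using h p w

theorem langFrom_congr_of_maxConst_lt {x x' : ℝ≥0} (hx : (A.maxConst : ℝ≥0) < x)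
    (hx' : (A.maxConst : ℝ≥0) < x') (q : Option ℕ) : A.langFrom (q, x) = A.langFrom (q, x') := by
  ext w
  induction w generalizing q x x' with
  | nil => rfl
  | cons p w ih =>
    have hxp : (A.maxConst : ℝ≥0) < x + p.1 := hx.trans_le le_self_add
    have hxp' : (A.maxConst : ℝ≥0) < x' + p.1 := hx'.trans_le le_self_add
    have hstep : A.step q p.2 (regionIndex (x + p.1)) = A.step q p.2 (regionIndex (x' + p.1)) := by
      rw [← step_min, min_eq_right (two_mul_lt_regionIndex.2 hxp), ← step_min A q p.2
        (regionIndex (x' + p.1)), min_eq_right (two_mul_lt_regionIndex.2 hxp')]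
    change w ∈ A.langFrom (A.timedRead (q, x) p) ↔ w ∈ A.langFrom (A.timedRead (q, x') p)
    simp only [timedRead, read, hstep]
    cases (A.step q p.2 (regionIndex (x' + p.1))).2
    exacts [ih hxp hxp' _, Iff.rfl]

end OneTA

/-- Position of a real number relative to the integers: `2 * n` for the integer `n`, and
`2 * n + 1` for the reals strictly between `n` and `n + 1`. -/
noncomputable def unitCell (z : ℝ) : ℤ := ⌊z⌋ + ⌈z⌉

theorem floor_eq_floor_of_unitCell_eq {z z' : ℝ} (h : unitCell z = unitCell z') :
    ⌊z⌋ = ⌊z'⌋ := by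
  have h₁ := Int.floor_le_ceil z
  have h₂ := Int.ceil_le_floor_add_one z
  have h₃ := Int.floor_le_ceil z'
  have h₄ := Int.ceil_le_floor_add_one z'
  unfold unitCell at h
  omega

theorem unitCell_add_intCast (z : ℝ) (n : ℤ) : unitCell (z + n) = unitCell z + 2 * n := by
  rw [unitCell, unitCell, Int.floor_add_intCast, Int.ceil_add_intCast]
  ring

theorem unitCell_neg (z : ℝ) : unitCell (-z) = -unitCell z := by
  rw [unitCell, unitCell, Int.floor_neg, Int.ceil_neg]
  ring

theorem unitCell_eq_of_mem_Ioo {z : ℝ} {n : ℤ} (h : z ∈ Set.Ioo (n : ℝ) (n + 1)) :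
    unitCell z = 2 * n + 1 := by
  have hf : ⌊z⌋ = n := Int.floor_eq_iff.2 ⟨h.1.le, h.2⟩
  have hc : ⌈z⌉ = n + 1 := Int.ceil_eq_iff.2 ⟨by simpa using h.1, by simpa using h.2.le⟩
  rw [unitCell, hf, hc]
  ring

theorem unitCell_coe (x : ℝ≥0) : unitCell x = regionIndex x := by
  rw [unitCell, ← Int.natCast_floor_eq_floor x.coe_nonneg, ← Int.natCast_ceil_eq_ceil x.coe_nonneg,
    ← Nat.cast_add]
  rfl

theorem unitCell_coe_inj {x y : ℝ≥0} : unitCell x = unitCell y ↔ regionIndex x = regionIndex y := by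
  rw [unitCell_coe, unitCell_coe, Nat.cast_inj]

theorem unitCell_sub_of_lt {x x' : ℝ≥0} (h : regionIndex x = regionIndex x') (hlt : x < x') :
    unitCell ((x : ℝ) - x') = -1 := by
  have hfloor := floor_eq_floor_of_unitCell_eq (unitCell_coe_inj.2 h)
  have hle : (x' : ℝ) < ⌊(x : ℝ)⌋ + 1 := by
    rw [hfloor]
    exact Int.lt_floor_add_one _
  have hge := Int.floor_le (x : ℝ)
  rw [← NNReal.coe_lt_coe] at hlt
  rw [unitCell_eq_of_mem_Ioo (n := -1) ⟨by push_cast; linarith, by push_cast; linarith⟩]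
  norm_num

theorem exists_unitCell_sub_eq {ι : Type*} [Finite ι] [Nonempty ι] {p q : ι → ℝ}
    (h : ∀ i j, unitCell (p i - p j) = unitCell (q i - q j)) (z : ℝ) :
    ∃ z' : ℝ, ∀ i, unitCell (z - p i) = unitCell (z' - q i) := by
  by_cases hz : ∃ i, ∃ m : ℤ, z = p i + m
  · obtain ⟨i, m, rfl⟩ := hz
    refine ⟨q i + m, fun j => ?_⟩
    rw [add_sub_right_comm, add_sub_right_comm, unitCell_add_intCast, unitCell_add_intCast, h]
  · have hfloor : ∀ i, (⌊z - p i⌋ : ℝ) < z - p i := fun i =>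
      lt_of_le_of_ne (Int.floor_le _) fun he => hz ⟨i, ⌊z - p i⌋, by rw [he]; ring⟩
    obtain ⟨i, hi⟩ := Finite.exists_max fun i => q i + ⌊z - p i⌋
    obtain ⟨j, hj⟩ := Finite.exists_min fun i => q i + ⌊z - p i⌋ + 1
    have hlt : q i + ⌊z - p i⌋ < q j + ⌊z - p j⌋ + 1 := by
      have hp : ⌊p i - p j⌋ < ⌊z - p j⌋ + 1 - ⌊z - p i⌋ := by
        rw [Int.floor_lt]
        push_cast
        linarith [hfloor i, Int.lt_floor_add_one (z - p j)]
      rw [floor_eq_floor_of_unitCell_eq (h i j), Int.floor_lt] at hp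
      push_cast at hp
      linarith
    obtain ⟨z', hz'⟩ := exists_between hlt
    refine ⟨z', fun k => ?_⟩
    rw [unitCell_eq_of_mem_Ioo ⟨hfloor k, Int.lt_floor_add_one _⟩, eq_comm]
    exact unitCell_eq_of_mem_Ioo ⟨by linarith [hi k], by linarith [hj k]⟩

/-- Equality of the regions of the pairs of clock values `(x, x')` and `(y, y')`, as far as they
matter to a timed automaton without maximum constant. -/
structure SameRegion (x x' y y' : ℝ≥0) : Prop where
  left : regionIndex x = regionIndex y
  right : regionIndex x' = regionIndex y'
  sub : unitCell ((x : ℝ) - x') = unitCell ((y : ℝ) - y')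

namespace SameRegion

variable {x x' y y' : ℝ≥0}

theorem symm (h : SameRegion x x' y y') : SameRegion y y' x x' :=
  ⟨h.left.symm, h.right.symm, h.sub.symm⟩

theorem swap (h : SameRegion x x' y y') : SameRegion x' x y' y :=
  ⟨h.right, h.left, by rw [← neg_sub, unitCell_neg, h.sub, ← unitCell_neg, neg_sub]⟩

theorem zero_right (h : regionIndex x = regionIndex y) : SameRegion x 0 y 0 :=
  ⟨h, rfl, by simp [unitCell_coe, h]⟩

theorem resetIf (h : SameRegion x x' y y') (b b' : Bool) :
    SameRegion (resetIf b x) (resetIf b' x') (resetIf b y) (resetIf b' y') := by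
  cases b <;> cases b'
  exacts [h, zero_right h.left, (zero_right h.right).swap, ⟨rfl, rfl, rfl⟩]

theorem of_lt (hx : regionIndex x = regionIndex y) (hx' : regionIndex x' = regionIndex y)
    (hy' : regionIndex y' = regionIndex y) (hlt : x < x') (hlt' : y < y') :
    SameRegion x x' y y' :=
  ⟨hx, hx'.trans hy'.symm, (unitCell_sub_of_lt (hx.trans hx'.symm) hlt).trans
    (unitCell_sub_of_lt hy'.symm hlt').symm⟩

/-- Time can be let pass from one pair so as to mirror the delay `t` from the other: a delay is a
point to be placed relative to the current time and the two instants of the last resets. -/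
theorem exists_delay (h : SameRegion x x' y y') (t : ℝ≥0) :
    ∃ t' : ℝ≥0, SameRegion (x + t) (x' + t) (y + t') (y' + t') := by
  have hl := unitCell_coe_inj.2 h.left
  have hr := unitCell_coe_inj.2 h.right
  have hpos : ∀ i j : Fin 3,
      unitCell ((![0, -x, -x'] : Fin 3 → ℝ) i - (![0, -x, -x'] : Fin 3 → ℝ) j) =
        unitCell ((![0, -y, -y'] : Fin 3 → ℝ) i - (![0, -y, -y'] : Fin 3 → ℝ) j) := by
    have hsub := h.sub
    have hsub' := h.swap.sub
    intro i j
    fin_cases i <;> fin_cases j <;> simp_all [unitCell_neg, add_comm, ← sub_eq_add_neg]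
  obtain ⟨z, hz⟩ := exists_unitCell_sub_eq hpos t
  have hz0 : unitCell t = unitCell z := by simpa using hz 0
  lift z to ℝ≥0 using by
    rw [← Int.floor_nonneg, ← floor_eq_floor_of_unitCell_eq hz0]
    exact Int.floor_nonneg.2 t.coe_nonneg
  refine ⟨z, unitCell_coe_inj.1 ?_, unitCell_coe_inj.1 ?_, by simpa using h.sub⟩
  · simpa [add_comm] using hz 1
  · simpa [add_comm] using hz 2

end SameRegion

namespace OneTA

variable {α : Type*} [DecidableEq α] {A A' : OneTA α} {x x' y y' : ℝ≥0}

theorem langAt_eq_of_sameRegion (h : SameRegion x x' y y') {q q' : Option ℕ} {n : ℕ}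
    (heq : A.langAt n (q, y) = A'.langAt n (q', y')) :
    A.langAt n (q, x) = A'.langAt n (q', x') := by
  induction n generalizing x x' y y' q q' with
  | zero => rwa [langAt_zero_eq_iff] at heq ⊢
  | succ n ih =>
    refine langAt_succ_eq_iff.2 fun p => ?_
    obtain ⟨t', ht'⟩ := h.exists_delay p.1
    have hread := langAt_succ_eq_iff.1 heq (t', p.2)
    simp only [timedRead, read, ← ht'.left, ← ht'.right] at hread
    exact ih (ht'.resetIf _ _) hread

theorem langAt_eq_iff_of_sameRegion (h : SameRegion x x' y y') {q q' : Option ℕ} {n : ℕ} :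
    A.langAt n (q, x) = A'.langAt n (q', x') ↔ A.langAt n (q, y) = A'.langAt n (q', y') :=
  ⟨langAt_eq_of_sameRegion h.symm, langAt_eq_of_sameRegion h⟩

theorem langFrom_eq_of_sameRegion (h : SameRegion x x' y y') {q q' : Option ℕ}
    (heq : A.langFrom (q, y) = A'.langFrom (q', y')) :
    A.langFrom (q, x) = A'.langFrom (q', x') :=
  langFrom_eq_iff_langAt.2 fun n => langAt_eq_of_sameRegion h (langFrom_eq_iff_langAt.1 heq n)

theorem langFrom_congr_of_lt {r : ℕ} {q : Option ℕ} (hx : regionIndex x = r)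
    (hx' : regionIndex x' = r) (hlt : x < x') (heq : A.langFrom (q, x) = A.langFrom (q, x'))
    (hy : regionIndex y = r) (hy' : regionIndex y' = r) :
    A.langFrom (q, y) = A.langFrom (q, y') := by
  subst hx
  rcases lt_trichotomy y y' with h | h | h
  · exact langFrom_eq_of_sameRegion (.of_lt hy hy' hx' h hlt) heq
  · rw [h]
  · exact (langFrom_eq_of_sameRegion (.of_lt hy' hy hx' h hlt) heq).symm

/-- A recognizable language is accepted with clock value zero, which does not move when the given
clock value is moved within its region. -/
theorem langFrom_congr_of_recognizable {q : Option ℕ} (h : Recognizable (A.langFrom (q, x)))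
    (hxy : regionIndex x = regionIndex y) : A.langFrom (q, y) = A.langFrom (q, x) := by
  obtain ⟨B, hB, hlang⟩ := h
  rw [hB.lang_eq_langFrom] at hlang
  rw [← hlang]
  exact langFrom_eq_of_sameRegion (.zero_right hxy.symm) hlang.symm

end OneTA

theorem eq_succ_of_card_le {β : Type*} {R : ℕ → Finset β} {S : Finset β} (hmono : Monotone R)
    (hRS : ∀ m, R m ⊆ S) (hstable : ∀ m, R m = R (m + 1) → R (m + 1) = R (m + 2)) {n : ℕ}
    (hn : S.card ≤ n) : R n = R (n + 1) := by
  have hcard : ∀ m, S.card ≤ m → (R m).card = (R S.card).card := fun m =>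
    Nat.stabilises_of_monotone (fun _ _ h => Finset.card_le_card (hmono h))
      (fun m => Finset.card_le_card (hRS m)) fun m h =>
        congrArg _ (hstable m (Finset.eq_of_subset_of_card_le (hmono m.le_succ) h.ge))
  exact Finset.eq_of_subset_of_card_le (hmono n.le_succ)
    ((hcard _ (hn.trans n.le_succ)).trans (hcard n hn).symm).le

section Reachability

variable {β : Type*} {succ : β → List β} {b c : β} {n : ℕ}

/-- The elements that are reached from `c` in at most `n` steps to successors, as a list so that
they can be computed. -/
def reachableUpTo (succ : β → List β) (n : ℕ) (c : β) : List β :=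
  (fun l => l ++ l.flatMap succ)^[n] [c]

theorem mem_reachableUpTo_succ_iff : b ∈ reachableUpTo succ (n + 1) c ↔
    b ∈ reachableUpTo succ n c ∨ ∃ a ∈ reachableUpTo succ n c, b ∈ succ a := by
  simp only [reachableUpTo, Function.iterate_succ_apply', List.mem_append, List.mem_flatMap]

theorem reachableUpTo_subset {m : ℕ} (h : m ≤ n) :
    reachableUpTo succ m c ⊆ reachableUpTo succ n c := by
  induction h with
  | refl => exact List.Subset.refl _
  | step _ ih => exact fun a ha => mem_reachableUpTo_succ_iff.2 (.inl (ih ha))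

theorem reflTransGen_of_mem_reachableUpTo (hb : b ∈ reachableUpTo succ n c) :
    Relation.ReflTransGen (fun a b => b ∈ succ a) c b := by
  induction n generalizing b with
  | zero => exact List.mem_singleton.1 hb ▸ .refl
  | succ n ih =>
    rcases mem_reachableUpTo_succ_iff.1 hb with hb | ⟨a, ha, hab⟩
    exacts [ih hb, (ih ha).tail hab]

theorem reachableUpTo_succ_subset {S : Finset β} (hc : c ∈ S)
    (hS : ∀ a ∈ S, ∀ b ∈ succ a, b ∈ S) (hn : S.card ≤ n) :
    reachableUpTo succ (n + 1) c ⊆ reachableUpTo succ n c := by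
  classical
  have hRS : ∀ m, (reachableUpTo succ m c).toFinset ⊆ S := fun m a ha => by
    have hreach := reflTransGen_of_mem_reachableUpTo (List.mem_toFinset.1 ha)
    clear ha
    induction hreach with
    | refl => exact hc
    | tail _ hab ih => exact hS _ ih _ hab
  have heq := eq_succ_of_card_le (R := fun m => (reachableUpTo succ m c).toFinset)
    (fun _ _ h a ha => by
      simpa using reachableUpTo_subset h (List.mem_toFinset.1 ha)) hRS
    (fun m h => by
      simp only [Finset.ext_iff, List.mem_toFinset] at h ⊢
      intro a
      rw [mem_reachableUpTo_succ_iff, mem_reachableUpTo_succ_iff (n := m + 1)]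
      simp only [h]) hn
  exact fun a ha => List.mem_toFinset.1 (heq ▸ List.mem_toFinset.2 ha)

theorem mem_reachableUpTo_iff {S : Finset β} (hc : c ∈ S) (hS : ∀ a ∈ S, ∀ b ∈ succ a, b ∈ S)
    (hn : S.card ≤ n) : b ∈ reachableUpTo succ n c ↔
      Relation.ReflTransGen (fun a b => b ∈ succ a) c b := by
  refine ⟨reflTransGen_of_mem_reachableUpTo, fun h => ?_⟩
  induction h with
  | refl => exact reachableUpTo_subset n.zero_le (List.mem_singleton_self c)
  | tail _ hab ih =>
    exact reachableUpTo_succ_subset hc hS hn (mem_reachableUpTo_succ_iff.2 (.inr ⟨_, ih, hab⟩))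

end Reachability

theorem eq_of_forall_two_mul {m n : ℕ} (hlt : ∀ c, 2 * c < m ↔ 2 * c < n)
    (hgt : ∀ c, m < 2 * c ↔ n < 2 * c) : m = n := by
  have h₁ := hlt (n / 2)
  have h₂ := hgt ((m + 1) / 2)
  have h₃ := hgt ((n + 1) / 2)
  omega

theorem regionIndex_mono : Monotone regionIndex := fun _ _ h =>
  add_le_add (Nat.floor_mono h) (Nat.ceil_mono h)

theorem regionIndex_natCast_div_two (n : ℕ) : regionIndex ((n : ℝ≥0) / 2) = n := by
  refine eq_of_forall_two_mul (fun c => ?_) fun c => ?_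
  · rw [two_mul_lt_regionIndex, lt_div_iff₀' two_pos]
    exact_mod_cast Iff.rfl
  · rw [regionIndex_lt_two_mul, div_lt_iff₀' two_pos]
    exact_mod_cast Iff.rfl

/-- Index of the region of the clock value `n / 4`. -/
def quarterIndex (n : ℕ) : ℕ := n / 4 + (n + 3) / 4

theorem regionIndex_natCast_div_four (n : ℕ) : regionIndex ((n : ℝ≥0) / 4) = quarterIndex n := by
  unfold quarterIndex
  refine eq_of_forall_two_mul (fun c => ?_) fun c => ?_
  · rw [two_mul_lt_regionIndex, lt_div_iff₀' four_pos,
      show (4 : ℝ≥0) * c < n ↔ 4 * c < n by exact_mod_cast Iff.rfl]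
    omega
  · rw [regionIndex_lt_two_mul, div_lt_iff₀' four_pos,
      show (n : ℝ≥0) < 4 * c ↔ n < 4 * c by exact_mod_cast Iff.rfl]
    omega

theorem quarterIndex_regionIndex_two_mul (z : ℝ≥0) :
    quarterIndex (regionIndex (2 * z)) = regionIndex z := by
  unfold quarterIndex
  refine eq_of_forall_two_mul (fun c => ?_) fun c => ?_
  · have h : 2 * (2 * c) < regionIndex (2 * z) ↔ 2 * c < regionIndex z := by
      rw [two_mul_lt_regionIndex, two_mul_lt_regionIndex, Nat.cast_mul, Nat.cast_ofNat,
        mul_lt_mul_iff_right₀ two_pos]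
    rw [← h]
    omega
  · have h : regionIndex (2 * z) < 2 * (2 * c) ↔ regionIndex z < 2 * c := by
      rw [regionIndex_lt_two_mul, regionIndex_lt_two_mul, Nat.cast_mul, Nat.cast_ofNat,
        mul_lt_mul_iff_right₀ two_pos]
    rw [← h]
    omega

theorem SameRegion.exists_quarters {n n' : ℕ} (hmod : n % 2 = n' % 2) (t : ℝ≥0) :
    ∃ d : ℕ, SameRegion ((n : ℝ≥0) / 4 + t) (n' / 4 + t) ((n + d : ℕ) / 4) ((n' + d : ℕ) / 4) := by
  wlog hle : n ≤ n' generalizing n n'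
  · obtain ⟨d, hd⟩ := this hmod.symm (le_of_not_ge hle)
    exact ⟨d, hd.swap⟩
  obtain ⟨k, rfl⟩ : ∃ k, n' = n + 2 * k := ⟨(n' - n) / 2, by omega⟩
  obtain ⟨d, hd⟩ : ∃ d, regionIndex (2 * ((n : ℝ≥0) / 4 + t)) = n + d := by
    refine Nat.exists_eq_add_of_le
      ((regionIndex_natCast_div_two n).ge.trans (regionIndex_mono ?_))
    calc (n : ℝ≥0) / 2 = 2 * (n / 4) := by ring
      _ ≤ 2 * (n / 4 + t) := by gcongr; exact le_self_add
  have hd' : regionIndex (2 * ((n + 2 * k : ℕ) / 4 + t)) = n + 2 * k + d := by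
    rw [add_right_comm, ← hd, add_comm (regionIndex _), ← regionIndex_natCast_add]
    congr 1
    push_cast
    ring
  refine ⟨d, ?_, ?_, ?_⟩
  · rw [← quarterIndex_regionIndex_two_mul, hd, regionIndex_natCast_div_four]
  · rw [← quarterIndex_regionIndex_two_mul, hd', regionIndex_natCast_div_four]
  · congr 1
    push_cast
    ring

/-- A representative below `4 * (K + 2)` of `n` for the purposes of an automaton with maximum
constant `K`, when `n` stands for the clock value `n / 4`. -/
def capQuarters (K n : ℕ) : ℕ := if n < 4 * (K + 2) then n else 4 * (K + 1) + n % 4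

theorem capQuarters_lt (K n : ℕ) : capQuarters K n < 4 * (K + 2) := by
  unfold capQuarters
  split_ifs <;> omega

theorem capQuarters_add_capQuarters (K n d : ℕ) :
    capQuarters K (n + capQuarters K d) = capQuarters K (n + d) := by
  unfold capQuarters
  split_ifs <;> omega

/-- Effect on a clock value, in quarters, of a step in which this clock is reset iff `b = true`
and the clock of the other configuration iff `b' = true`. When only the other one is reset, what
matters is the region alone, and this clock is moved to a multiple of one half, so that both clocks
keep the same parity in quarters. -/
def quarterReset (b b' : Bool) (n : ℕ) : ℕ :=
  bif b then 0 else bif b' then 2 * quarterIndex n else n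

theorem quarterReset_lt {K n : ℕ} (h : n < 4 * (K + 2)) (b b' : Bool) :
    quarterReset b b' n < 4 * (K + 2) := by
  cases b <;> cases b' <;> simp only [quarterReset, quarterIndex, cond_true, cond_false] <;> omega

theorem quarterReset_mod_two {n n' : ℕ} (h : n % 2 = n' % 2) (b b' : Bool) :
    quarterReset b b' n % 2 = quarterReset b' b n' % 2 := by
  cases b <;> cases b' <;> simp [quarterReset, h]

namespace OneTA

variable {α : Type*} [DecidableEq α] {A : OneTA α}

/-- A configuration of an automaton completed by a sink, given by a state and a clock value in
quarters. -/
abbrev QuarterConfig := Option ℕ × ℕ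

/-- The configuration with state `c.1` and clock value `c.2 / 4`. -/
noncomputable def QuarterConfig.toConfig (c : QuarterConfig) : Config := (c.1, c.2 / 4)

theorem langFrom_toConfig_cap (A : OneTA α) (q : Option ℕ) (n : ℕ) :
    A.langFrom (QuarterConfig.toConfig (q, capQuarters A.maxConst n)) =
      A.langFrom (QuarterConfig.toConfig (q, n)) := by
  by_cases hn : n < 4 * (A.maxConst + 2)
  · rw [capQuarters, if_pos hn]
  · have hlt : ∀ m, 4 * A.maxConst < m → (A.maxConst : ℝ≥0) < m / 4 := fun m hm => by
      rw [lt_div_iff₀' four_pos]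
      exact_mod_cast hm
    refine langFrom_congr_of_maxConst_lt (hlt _ ?_) (hlt _ ?_) q
    · rw [capQuarters, if_neg hn]
      omega
    · omega

theorem sameRegion_quarterReset (n n' : ℕ) (b b' : Bool) :
    SameRegion (resetIf b ((n : ℝ≥0) / 4)) (resetIf b' ((n' : ℝ≥0) / 4))
      (quarterReset b b' n / 4) (quarterReset b' b n' / 4) := by
  have hhalf : ∀ n : ℕ, regionIndex ((n : ℝ≥0) / 4) =
      regionIndex ((2 * quarterIndex n : ℕ) / 4) := fun n => by
    have h : (quarterIndex n : ℝ≥0) / 2 = (2 * quarterIndex n : ℕ) / 4 := by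
      push_cast
      ring
    rw [← h, regionIndex_natCast_div_two, regionIndex_natCast_div_four]
  cases b <;> cases b' <;>
    simp only [quarterReset, cond_true, cond_false, resetIf_true, resetIf_false, Nat.cast_zero,
      zero_div]
  exacts [⟨rfl, rfl, rfl⟩, .zero_right (hhalf n), (SameRegion.zero_right (hhalf n')).swap,
    ⟨rfl, rfl, rfl⟩]

/-- The pair of configurations, with clock values in quarters, that is reached by a delay of `d`
quarters and the letter `a`, up to a change that does not affect the comparison of the languages
accepted from the two configurations. -/
def quarterStep (A : OneTA α) (d : ℕ) (a : α) (c : QuarterConfig × QuarterConfig) :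
    QuarterConfig × QuarterConfig :=
  let n := capQuarters A.maxConst (c.1.2 + d)
  let n' := capQuarters A.maxConst (c.2.2 + d)
  let s := A.step c.1.1 a (quarterIndex n)
  let s' := A.step c.2.1 a (quarterIndex n')
  ((s.1, quarterReset s.2 s'.2 n), (s'.1, quarterReset s'.2 s.2 n'))

theorem quarterStep_capQuarters (d : ℕ) (a : α) (c : QuarterConfig × QuarterConfig) :
    A.quarterStep (capQuarters A.maxConst d) a c = A.quarterStep d a c := by
  simp only [quarterStep, capQuarters_add_capQuarters]

theorem quarterStep_mod_two {c : QuarterConfig × QuarterConfig} (hc : c.1.2 % 2 = c.2.2 % 2)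
    (d : ℕ) (a : α) : (A.quarterStep d a c).1.2 % 2 = (A.quarterStep d a c).2.2 % 2 := by
  refine quarterReset_mod_two ?_ _ _
  unfold capQuarters
  split_ifs <;> omega

theorem langAt_timedRead_eq_iff {c : QuarterConfig × QuarterConfig} {t : ℝ≥0} {d : ℕ} {a : α}
    (h : SameRegion ((c.1.2 : ℝ≥0) / 4 + t) (c.2.2 / 4 + t) ((c.1.2 + d : ℕ) / 4)
      ((c.2.2 + d : ℕ) / 4)) (n : ℕ) :
    A.langAt n (A.timedRead c.1.toConfig (t, a)) =
        A.langAt n (A.timedRead c.2.toConfig (t, a)) ↔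
      A.langAt n (A.quarterStep d a c).1.toConfig =
        A.langAt n (A.quarterStep d a c).2.toConfig := by
  have hcap : ∀ (q : Option ℕ) (m : ℕ), A.langAt n (A.read (QuarterConfig.toConfig (q, m)) a) =
      A.langAt n (A.read (QuarterConfig.toConfig (q, capQuarters A.maxConst m)) a) := fun q m =>
    langFrom_eq_iff_langAt.1 (langFrom_read_congr (A.langFrom_toConfig_cap q m).symm a) n
  have hread : A.langAt n (A.timedRead c.1.toConfig (t, a)) =
        A.langAt n (A.timedRead c.2.toConfig (t, a)) ↔
      A.langAt n (A.read (QuarterConfig.toConfig (c.1.1, c.1.2 + d)) a) =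
        A.langAt n (A.read (QuarterConfig.toConfig (c.2.1, c.2.2 + d)) a) := by
    simp only [timedRead, read, QuarterConfig.toConfig, h.left, h.right]
    exact langAt_eq_iff_of_sameRegion (h.resetIf _ _)
  rw [hread, hcap c.1.1 (c.1.2 + d), hcap c.2.1 (c.2.2 + d)]
  simp only [read, QuarterConfig.toConfig, quarterStep, regionIndex_natCast_div_four]
  exact langAt_eq_iff_of_sameRegion (sameRegion_quarterReset _ _ _ _)

/-- The pairs of configurations, with clock values in quarters, that are reached from `c` by one
timed letter with letter from `l`. -/
def quarterSucc (A : OneTA α) (l : List α) (c : QuarterConfig × QuarterConfig) :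
    List (QuarterConfig × QuarterConfig) :=
  (List.range (4 * (A.maxConst + 2))).flatMap fun d => l.map fun a => A.quarterStep d a c

theorem mem_quarterSucc_iff {l : List α} (hl : ∀ a, a ∈ l)
    {c c' : QuarterConfig × QuarterConfig} :
    c' ∈ A.quarterSucc l c ↔ ∃ d a, A.quarterStep d a c = c' := by
  simp only [quarterSucc, List.mem_flatMap, List.mem_range, List.mem_map]
  refine ⟨fun ⟨d, _, a, _, h⟩ => ⟨d, a, h⟩, fun ⟨d, a, h⟩ => ?_⟩
  exact ⟨_, capQuarters_lt _ d, a, hl a, (A.quarterStep_capQuarters d a c).trans h⟩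

theorem langFrom_toConfig_eq_iff {l : List α} (hl : ∀ a, a ∈ l)
    {c : QuarterConfig × QuarterConfig} (hc : c.1.2 % 2 = c.2.2 % 2) :
    A.langFrom c.1.toConfig = A.langFrom c.2.toConfig ↔
      ∀ c', Relation.ReflTransGen (fun c c' => c' ∈ A.quarterSucc l c) c c' →
        (A.Accepting c'.1.1 ↔ A.Accepting c'.2.1) := by
  rw [langFrom_eq_iff_langAt]
  constructor
  · intro h c' hreach
    suffices ∀ n, A.langAt n c'.1.toConfig = A.langAt n c'.2.toConfig from
      langAt_zero_eq_iff.1 (this 0)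
    induction hreach using Relation.ReflTransGen.head_induction_on with
    | refl => exact h
    | head hstep _ ih =>
      obtain ⟨d, a, rfl⟩ := (mem_quarterSucc_iff hl).1 hstep
      refine ih (quarterStep_mod_two hc d a) fun n => ?_
      refine (langAt_timedRead_eq_iff (t := d / 4) ⟨?_, ?_, ?_⟩ n).1
        (langAt_succ_eq_iff.1 (h (n + 1)) _)
      all_goals congr 1; push_cast; ring
  · intro h n
    induction n generalizing c with
    | zero => exact langAt_zero_eq_iff.2 (h c .refl)
    | succ n ih =>
      refine langAt_succ_eq_iff.2 fun (t, a) => ?_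
      obtain ⟨d, hd⟩ := SameRegion.exists_quarters hc t
      refine (langAt_timedRead_eq_iff hd n).2 (ih (quarterStep_mod_two hc d a) fun c' hc' => ?_)
      exact h c' (hc'.head ((mem_quarterSucc_iff hl).2 ⟨d, a, rfl⟩))

end OneTA

/-- Index of the `K`-region of a clock value: all values above `K` share the index `2 * K + 1`. -/
noncomputable def cappedIndex (K : ℕ) (x : ℝ≥0) : ℕ := min (regionIndex x) (2 * K + 1)

theorem cappedIndex_le (K : ℕ) (x : ℝ≥0) : cappedIndex K x ≤ 2 * K + 1 := min_le_right _ _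

theorem cappedIndex_eq_last_iff {K : ℕ} {x : ℝ≥0} :
    cappedIndex K x = 2 * K + 1 ↔ (K : ℝ≥0) < x := by
  rw [cappedIndex, min_eq_right_iff, ← two_mul_lt_regionIndex, Nat.succ_le_iff]

theorem cappedIndex_eq_iff_of_le {K r : ℕ} (hr : r ≤ 2 * K) {x : ℝ≥0} :
    cappedIndex K x = r ↔ regionIndex x = r := by
  unfold cappedIndex
  omega

namespace OneTA

variable {α : Type*} [DecidableEq α] {A : OneTA α} {l : List α} {q : Option ℕ} {r : ℕ}

theorem step_cappedIndex (A : OneTA α) (q : Option ℕ) (a : α) (x : ℝ≥0) :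
    A.step q a (cappedIndex A.maxConst x) = A.step q a (regionIndex x) :=
  A.step_min q a _

/-- The pairs of configurations in quarters that are reached from a given pair. The number of
iterations is that of the pairs in which the clock values are capped. -/
def reachableQuarters (A : OneTA α) (l : List α) (c : QuarterConfig × QuarterConfig) :
    List (QuarterConfig × QuarterConfig) :=
  reachableUpTo (A.quarterSucc l) ((A.states.length * (4 * (A.maxConst + 2))) ^ 2) c

theorem mem_reachableQuarters_iff {c c' : QuarterConfig × QuarterConfig}
    (hq : c.1.1 ∈ A.states) (hn : c.1.2 < 4 * (A.maxConst + 2)) (hq' : c.2.1 ∈ A.states)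
    (hn' : c.2.2 < 4 * (A.maxConst + 2)) : c' ∈ A.reachableQuarters l c ↔
      Relation.ReflTransGen (fun c c' => c' ∈ A.quarterSucc l c) c c' := by
  let C : Finset QuarterConfig := A.states.toFinset ×ˢ Finset.range (4 * (A.maxConst + 2))
  refine mem_reachableUpTo_iff (S := C ×ˢ C) ?_ (fun c _ c' hc' => ?_) ?_
  · simp [C, hq, hn, hq', hn']
  · simp only [quarterSucc, List.mem_flatMap, List.mem_map] at hc'
    obtain ⟨d, _, a, _, rfl⟩ := hc'
    simp [C, quarterStep, step_fst_mem_states, quarterReset_lt, capQuarters_lt]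
  · simp only [C, Finset.card_product, Finset.card_range, sq]
    gcongr <;> exact List.toFinset_card_le _

/-- Acceptance from state `c.1` is the same for all clock values in the `K`-region with index
`c.2`, in a form that can be decided: an open interval `(j, j + 1)` is represented by its points
`j + 1 / 4` and `j + 3 / 4`. -/
def Resettable (A : OneTA α) (l : List α) (c : Option ℕ × ℕ) : Prop :=
  c.2 % 2 = 0 ∨ ∀ d ∈ A.reachableQuarters l ((c.1, 2 * c.2 - 1), (c.1, 2 * c.2 + 1)),
    (A.Accepting d.1.1 ↔ A.Accepting d.2.1)

instance (A : OneTA α) (l : List α) : DecidablePred (A.Resettable l) := fun _ =>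
  inferInstanceAs (Decidable (_ ∨ _))

theorem langFrom_congr_of_cappedIndex_eq {x x' y y' : ℝ≥0} (hx : cappedIndex A.maxConst x = r)
    (hx' : cappedIndex A.maxConst x' = r) (hlt : x < x')
    (heq : A.langFrom (q, x) = A.langFrom (q, x')) (hy : cappedIndex A.maxConst y = r)
    (hy' : cappedIndex A.maxConst y' = r) : A.langFrom (q, y) = A.langFrom (q, y') := by
  rcases (hx ▸ cappedIndex_le _ _ : r ≤ 2 * A.maxConst + 1).eq_or_lt with rfl | hr
  · rw [cappedIndex_eq_last_iff] at hy hy'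
    exact langFrom_congr_of_maxConst_lt hy hy' q
  · rw [cappedIndex_eq_iff_of_le (Nat.lt_succ_iff.1 hr)] at hx hx' hy hy'
    exact langFrom_congr_of_lt hx hx' hlt heq hy hy'

theorem resettable_iff (hl : ∀ a, a ∈ l) (hq : q ∈ A.states) (hr : r ≤ 2 * A.maxConst + 1) :
    A.Resettable l (q, r) ↔ ∀ x x', cappedIndex A.maxConst x = r →
      cappedIndex A.maxConst x' = r → A.langFrom (q, x) = A.langFrom (q, x') := by
  rcases Nat.even_or_odd' r with ⟨j, rfl | rfl⟩
  · refine iff_of_true (.inl (Nat.mul_mod_right 2 j)) fun x x' hx hx' => ?_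
    rw [cappedIndex_eq_iff_of_le (by omega), regionIndex_eq_two_mul] at hx hx'
    rw [hx, hx']
  have hindex : ∀ n, quarterIndex n = 2 * j + 1 →
      cappedIndex A.maxConst (n / 4) = 2 * j + 1 := fun n hn => by
    rw [cappedIndex, regionIndex_natCast_div_four, hn, min_eq_left hr]
  have h₁ := hindex (2 * (2 * j + 1) - 1) (by unfold quarterIndex; omega)
  have h₂ := hindex (2 * (2 * j + 1) + 1) (by unfold quarterIndex; omega)
  have hres : A.Resettable l (q, 2 * j + 1) ↔
      A.langFrom (q, (2 * (2 * j + 1) - 1 : ℕ) / 4) =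
        A.langFrom (q, (2 * (2 * j + 1) + 1 : ℕ) / 4) := by
    refine Iff.trans ?_ (langFrom_toConfig_eq_iff hl
      (c := ((q, 2 * (2 * j + 1) - 1), (q, 2 * (2 * j + 1) + 1))) (by dsimp only; omega)).symm
    simp only [Resettable]
    rw [or_iff_right (by omega)]
    refine forall_congr' fun d => imp_congr_left ?_
    exact mem_reachableQuarters_iff hq (by dsimp only; omega) hq (by dsimp only; omega)
  refine hres.trans ⟨fun h x x' => ?_, fun h => h _ _ h₁ h₂⟩
  refine langFrom_congr_of_cappedIndex_eq h₁ h₂ ?_ h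
  gcongr
  omega

theorem resettable_of_even (l : List α) (q : Option ℕ) (hr : r % 2 = 0) : A.Resettable l (q, r) :=
  .inl hr

theorem odd_and_lt_of_not_resettable (hl : ∀ a, a ∈ l) (hq : q ∈ A.states)
    (hr : r ≤ 2 * A.maxConst + 1) (h : ¬ A.Resettable l (q, r)) :
    r % 2 = 1 ∧ r < 2 * A.maxConst := by
  have hodd : r % 2 ≠ 0 := mt (resettable_of_even l q) h
  have hne : r ≠ 2 * A.maxConst + 1 := by
    rintro rfl
    refine h ((resettable_iff hl hq hr).2 fun x x' hx hx' => ?_)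
    rw [cappedIndex_eq_last_iff] at hx hx'
    exact langFrom_congr_of_maxConst_lt hx hx' q
  omega

theorem resettable_of_recognizable (hl : ∀ a, a ∈ l) (hq : q ∈ A.states) {x : ℝ≥0}
    (h : Recognizable (A.langFrom (q, x))) : A.Resettable l (q, cappedIndex A.maxConst x) := by
  refine (resettable_iff hl hq (cappedIndex_le _ _)).2 ?_
  suffices ∀ y, cappedIndex A.maxConst y = cappedIndex A.maxConst x →
      A.langFrom (q, y) = A.langFrom (q, x) from
    fun y y' hy hy' => (this y hy).trans (this y' hy').symm
  intro y hy
  rcases (cappedIndex_le A.maxConst x).eq_or_lt with hx | hx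
  · rw [hx] at hy
    rw [cappedIndex_eq_last_iff] at hx hy
    exact langFrom_congr_of_maxConst_lt hy hx q
  · have hxy := (cappedIndex_eq_iff_of_le (Nat.lt_succ_iff.1 hx)).1 hy
    rw [← (cappedIndex_eq_iff_of_le (Nat.lt_succ_iff.1 hx)).1 rfl] at hxy
    exact langFrom_congr_of_recognizable h hxy.symm

end OneTA

/-- A clock constraint that defines the `K`-region with index `s`. -/
def regionGuard (K s : ℕ) : Guard :=
  if s % 2 = 0 then (.eq (s / 2), [])
  else if s < 2 * K + 1 then (.gt (s / 2), [.lt (s / 2 + 1)])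
  else (.gt (s / 2), [])

theorem mem_denote_regionGuard_iff {K s : ℕ} (hs : s ≤ 2 * K + 1) {x : ℝ≥0} :
    x ∈ Guard.denote (regionGuard K s) ↔ cappedIndex K x = s := by
  rw [Guard.mem_denote_iff, cappedIndex, regionGuard]
  split_ifs <;> simp only [Guard.sat, Guard.atoms, Atom.sat, List.all_cons, List.all_nil,
    Bool.and_true, Bool.and_eq_true, decide_eq_true_eq] <;> omega

theorem const_le_of_mem_regionGuard {K s : ℕ} (hs : s ≤ 2 * K + 1) {c : Atom}
    (hc : c ∈ Guard.atoms (regionGuard K s)) : c.const ≤ K := by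
  unfold regionGuard at hc
  split_ifs at hc <;> simp only [Guard.atoms, List.mem_cons, List.not_mem_nil, or_false] at hc
  · rw [hc, Atom.const]
    omega
  · rcases hc with rfl | rfl <;> simp only [Atom.const] <;> omega
  · rw [hc, Atom.const]
    omega

theorem isRegion_regionGuard {K s : ℕ} (hs : s ≤ 2 * K + 1) :
    IsRegion K (Guard.denote (regionGuard K s)) := by
  have hdenote : Guard.denote (regionGuard K s) = {x | cappedIndex K x = s} :=
    Set.ext fun x => mem_denote_regionGuard_iff hs
  rw [hdenote]
  rcases hs.eq_or_lt with rfl | hs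
  · exact .inr (.inr (Set.ext fun x => cappedIndex_eq_last_iff))
  simp only [cappedIndex_eq_iff_of_le (Nat.lt_succ_iff.1 hs)]
  rcases Nat.even_or_odd' s with ⟨c, rfl | rfl⟩
  · exact .inl ⟨c, by omega, Set.ext fun x => regionIndex_eq_two_mul⟩
  · exact .inr (.inl ⟨c, by omega, Set.ext fun x => regionIndex_eq_two_mul_add_one⟩)

/-- Index of the region reached by a delay in the region with index `s` from a value in the region
with index `r`. Where this depends on the value, it is taken just above the infimum of its
region. -/
def shiftIndex (r s : ℕ) : ℕ := r + if r % 2 = 0 then s else 2 * (s / 2)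

theorem exists_lt_regionIndex_add_eq (c : ℕ) (t : ℝ≥0) : ∃ x x' : ℝ≥0, x < x' ∧
    regionIndex x = 2 * c + 1 ∧ regionIndex x' = 2 * c + 1 ∧
      regionIndex (x + t) = shiftIndex (2 * c + 1) (regionIndex t) ∧
      regionIndex (x' + t) = shiftIndex (2 * c + 1) (regionIndex t) := by
  have hshift : shiftIndex (2 * c + 1) (regionIndex t) = 2 * (c + ⌊t⌋₊) + 1 := by
    have h₁ := Nat.floor_le_ceil t
    have h₂ := Nat.ceil_le_floor_add_one t
    rw [shiftIndex, if_neg (by omega), regionIndex]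
    omega
  obtain ⟨ε, hε, hεt⟩ := exists_pos_add_of_lt' (Nat.lt_floor_add_one t)
  have hε_le : ε ≤ 1 := by
    have := Nat.floor_le (zero_le : 0 ≤ t)
    by_contra! h
    exact (add_lt_add_of_le_of_lt this h).ne hεt.symm
  have hindex : ∀ e, 0 < e → e < ε → regionIndex (c + e) = 2 * c + 1 ∧
      regionIndex (c + e + t) = 2 * (c + ⌊t⌋₊) + 1 := by
    intro e he heε
    rw [regionIndex_eq_two_mul_add_one, regionIndex_eq_two_mul_add_one, Nat.cast_add]
    refine ⟨⟨lt_add_of_pos_right _ he, by gcongr; exact heε.trans_le hε_le⟩, ?_, ?_⟩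
    · rw [add_right_comm]
      exact lt_add_of_le_of_pos (by gcongr; exact Nat.floor_le zero_le) he
    · rw [add_assoc, add_assoc, ← hεt, add_comm e]
      gcongr
  obtain ⟨e', he', he'ε⟩ := exists_between hε
  obtain ⟨e, he, hee'⟩ := exists_between he'
  rw [hshift]
  exact ⟨c + e, c + e', by gcongr, (hindex e he (hee'.trans he'ε)).1, (hindex e' he' he'ε).1,
    (hindex e he (hee'.trans he'ε)).2, (hindex e' he' he'ε).2⟩

/-- `shiftIndex` for the indices of `K`-regions. -/
def cappedShiftIndex (K r s : ℕ) : ℕ := min (shiftIndex r s) (2 * K + 1)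

theorem cappedIndex_add_of_even {K r : ℕ} (hr : r % 2 = 0) {x : ℝ≥0} (hx : cappedIndex K x = r)
    (t : ℝ≥0) : cappedIndex K (x + t) = cappedShiftIndex K r (cappedIndex K t) := by
  obtain ⟨c, rfl⟩ : ∃ c, r = 2 * c := ⟨r / 2, by omega⟩
  have hle := hx ▸ cappedIndex_le K x
  rw [cappedIndex_eq_iff_of_le (by omega), regionIndex_eq_two_mul] at hx
  rw [hx, cappedShiftIndex, shiftIndex, if_pos hr, cappedIndex, cappedIndex,
    regionIndex_natCast_add]
  omega

theorem exists_lt_cappedIndex_add_eq {K r : ℕ} (hr : r % 2 = 1) (hrK : r ≤ 2 * K + 1) (t : ℝ≥0) :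
    ∃ x x' : ℝ≥0, x < x' ∧ cappedIndex K x = r ∧ cappedIndex K x' = r ∧
      cappedIndex K (x + t) = cappedShiftIndex K r (cappedIndex K t) ∧
      cappedIndex K (x' + t) = cappedShiftIndex K r (cappedIndex K t) := by
  obtain ⟨c, rfl⟩ : ∃ c, r = 2 * c + 1 := ⟨r / 2, by omega⟩
  obtain ⟨x, x', hlt, hx, hx', hxt, hxt'⟩ := exists_lt_regionIndex_add_eq c t
  have hmin : min (shiftIndex (2 * c + 1) (regionIndex t)) (2 * K + 1) =
      min (shiftIndex (2 * c + 1) (min (regionIndex t) (2 * K + 1))) (2 * K + 1) := by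
    rw [shiftIndex, shiftIndex, if_neg (by omega), if_neg (by omega)]
    omega
  refine ⟨x, x', hlt, ?_⟩
  simp only [cappedIndex, cappedShiftIndex, hx, hx', hxt, hxt', hmin, and_self, and_true]
  omega

theorem exists_cappedIndex_add_eq {K r : ℕ} (hr : r ≤ 2 * K + 1) (t : ℝ≥0) :
    ∃ x, cappedIndex K x = r ∧
      cappedIndex K (x + t) = cappedShiftIndex K r (cappedIndex K t) := by
  rcases Nat.mod_two_eq_zero_or_one r with h | h
  · have hx : cappedIndex K (r / 2 : ℕ) = r := by
      rw [cappedIndex, regionIndex_natCast]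
      omega
    exact ⟨_, hx, cappedIndex_add_of_even h hx t⟩
  · obtain ⟨x, -, -, hx, -, hxt, -⟩ := exists_lt_cappedIndex_add_eq h hr t
    exact ⟨x, hx, hxt⟩

theorem cappedIndex_resetIf (K : ℕ) (b : Bool) (x : ℝ≥0) :
    cappedIndex K (resetIf b x) = resetIf b (cappedIndex K x) := by
  cases b <;> simp [cappedIndex]

namespace OneTA

variable {α : Type*} [DecidableEq α] {A : OneTA α} {l : List α}

/-- The state of `A` and the index of the region of its clock after reading the letter `a` after a
delay in the region with index `s`, starting from state `c.1` in the region with index `c.2`. -/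
def regionRead (A : OneTA α) (c : Option ℕ × ℕ) (a : α) (s : ℕ) : Option ℕ × ℕ :=
  let r := cappedShiftIndex A.maxConst c.2 s
  ((A.step c.1 a r).1, resetIf (A.step c.1 a r).2 r)

theorem regionRead_fst_mem_states (A : OneTA α) (c : Option ℕ × ℕ) (a : α) (s : ℕ) :
    (A.regionRead c a s).1 ∈ A.states :=
  A.step_fst_mem_states _ _ _

/-- Target and reset of the canonical automaton of `A`. A state `c` consists of a state of `A` and
the index of the region in which the clock of `A` was when the clock of the canonical automaton was
last reset; `s` is the index of the region of the latter clock. -/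
def canonStep (A : OneTA α) (l : List α) (c : Option ℕ × ℕ) (a : α) (s : ℕ) :
    (Option ℕ × ℕ) × Bool :=
  if A.Resettable l (A.regionRead c a s) then (A.regionRead c a s, true)
  else (((A.regionRead c a s).1, c.2), false)

/-- The transition of the canonical automaton for `A.canonStep l c a s`. -/
def canonTransition (A : OneTA α) (l : List α) (c : Option ℕ × ℕ) (a : α) (s : ℕ) :
    Transition α where
  src := Encodable.encode c
  tgt := Encodable.encode (A.canonStep l c a s).1
  letter := a
  guard := regionGuard A.maxConst s
  reset := (A.canonStep l c a s).2

/-- The canonical automaton of `A`, which resets its clock exactly when the residual language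
becomes recognizable. The list `l` enumerates the alphabet. -/
def canon (l : List α) (A : OneTA α) : OneTA α where
  init := Encodable.encode (some A.init, 0)
  trans := A.states.flatMap fun q => (List.range (2 * A.maxConst + 2)).flatMap fun r =>
    l.flatMap fun a => (List.range (2 * A.maxConst + 2)).map fun s =>
      A.canonTransition l (q, r) a s
  final := A.final.flatMap fun f => (List.range (2 * A.maxConst + 2)).map fun r =>
    Encodable.encode (some f, r)

theorem mem_canon_trans {θ : Transition α} : θ ∈ (canon l A).trans ↔
    ∃ q ∈ A.states, ∃ r ≤ 2 * A.maxConst + 1, ∃ a ∈ l, ∃ s ≤ 2 * A.maxConst + 1,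
      A.canonTransition l (q, r) a s = θ := by
  simp only [canon, List.mem_flatMap, List.mem_map, List.mem_range, Nat.lt_succ_iff]

theorem encode_mem_canon_final {c : Option ℕ × ℕ} (hc : c.2 ≤ 2 * A.maxConst + 1) :
    Encodable.encode c ∈ (canon l A).final ↔ A.Accepting c.1 := by
  simp only [canon, List.mem_flatMap, List.mem_map, List.mem_range, Encodable.encode_inj,
    Accepting, Prod.ext_iff]
  exact exists_congr fun f => and_congr_right fun _ =>
    ⟨fun ⟨_, _, h, _⟩ => h, fun h => ⟨c.2, by omega, h, rfl⟩⟩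

theorem canon_deterministic (l : List α) (A : OneTA α) : (canon l A).Deterministic := by
  intro θ hθ θ' hθ' hne
  obtain ⟨q, -, r, -, a, -, s, hs, rfl⟩ := mem_canon_trans.1 hθ
  obtain ⟨q', -, r', -, a', -, s', hs', rfl⟩ := mem_canon_trans.1 hθ'
  by_contra! h
  obtain ⟨hsrc, rfl, x, hx, hx'⟩ := h
  obtain ⟨rfl, rfl⟩ := Prod.mk.inj (Encodable.encode_inj.1 hsrc)
  rw [canonTransition, mem_denote_regionGuard_iff hs] at hx
  rw [canonTransition, mem_denote_regionGuard_iff hs'] at hx'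
  obtain rfl := hx.symm.trans hx'
  exact hne rfl

theorem canon_maxConst (hl : ∀ a, a ∈ l) (A : OneTA α) : (canon l A).maxConst = A.maxConst := by
  apply le_antisymm
  · refine maxConst_le_iff.2 fun θ hθ c hc => ?_
    obtain ⟨q, -, r, -, a, -, s, hs, rfl⟩ := mem_canon_trans.1 hθ
    exact const_le_of_mem_regionGuard hs hc
  · refine maxConst_le_iff.2 fun θ hθ c hc => ?_
    have hmem : A.canonTransition l (some A.init, 0) θ.letter (2 * A.maxConst) ∈
        (canon l A).trans :=
      mem_canon_trans.2 ⟨_, A.init_mem_states, 0, Nat.zero_le _, _, hl _, _, Nat.le_succ _, rfl⟩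
    refine (const_le_maxConst hθ hc).trans (const_le_maxConst hmem (c := .eq A.maxConst) ?_)
    simp [canonTransition, regionGuard, Guard.atoms]

theorem canon_regionGuarded (hl : ∀ a, a ∈ l) (A : OneTA α) : (canon l A).RegionGuarded := by
  intro θ hθ
  rw [canon_maxConst hl]
  obtain ⟨q, -, r, -, a, -, s, hs, rfl⟩ := mem_canon_trans.1 hθ
  exact isRegion_regionGuard hs

theorem canon_run_cons (hl : ∀ a, a ∈ l) {c : Option ℕ × ℕ} (hq : c.1 ∈ A.states)
    (hr : c.2 ≤ 2 * A.maxConst + 1) {y t y' : ℝ≥0} {a : α} {w : TimedWord α} {q' : ℕ}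
    (h : (canon l A).Run (Encodable.encode (A.canonStep l c a (cappedIndex A.maxConst (y + t))).1)
      (resetIf (A.canonStep l c a (cappedIndex A.maxConst (y + t))).2 (y + t)) w q' y') :
    (canon l A).Run (Encodable.encode c) y ((t, a) :: w) q' y' := by
  refine .cons (A.canonTransition l c a (cappedIndex A.maxConst (y + t))) _ _ _ _ _ _ _ ?_ rfl rfl
    ?_ ?_
  · exact mem_canon_trans.2 ⟨_, hq, _, hr, a, hl a, _, cappedIndex_le _ _, rfl⟩
  · exact (mem_denote_regionGuard_iff (cappedIndex_le _ _)).2 rfl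
  · rwa [Transition.update_eq_resetIf]

/-- The state `c` and the clock value `y` of the canonical automaton of `A` represent the
language `L`. Only if the region of `A` with index `c.2` is a single point can `y` be positive. -/
structure Represents (A : OneTA α) (c : Option ℕ × ℕ) (y : ℝ≥0) (L : Set (TimedWord α)) :
    Prop where
  fst_mem : c.1 ∈ A.states
  snd_le : c.2 ≤ 2 * A.maxConst + 1
  clock : y = 0 ∨
    c.2 % 2 = 0 ∧ regionIndex y % 2 = 1 ∧ regionIndex y < 2 * A.maxConst
  lang_eq : ∀ x, cappedIndex A.maxConst x = c.2 → L = A.langFrom (c.1, x + y)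

theorem Deterministic.represents_init (hA : A.Deterministic) :
    A.Represents (some A.init, 0) 0 A.lang where
  fst_mem := A.init_mem_states
  snd_le := Nat.zero_le _
  clock := .inl rfl
  lang_eq x hx := by
    have hx0 := (regionIndex_eq_two_mul (c := 0)).1 ((cappedIndex_eq_iff_of_le zero_le).1 hx)
    rw [hA.lang_eq_langFrom, hx0, Nat.cast_zero, add_zero]

namespace Represents

variable {c : Option ℕ × ℕ} {y : ℝ≥0} {L : Set (TimedWord α)}

theorem mem_Icc_diff (h : A.Represents c y L) : y ∈ Set.Icc (0 : ℝ≥0) (A.maxConst : ℝ≥0) \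
    {x : ℝ≥0 | ∃ n : ℕ, 0 < n ∧ x = (n : ℝ≥0)} := by
  rcases h.clock with rfl | ⟨-, hodd, hlt⟩
  · exact ⟨⟨le_rfl, zero_le⟩, fun ⟨n, hn, h⟩ => hn.ne (by exact_mod_cast h)⟩
  · refine ⟨⟨zero_le, (regionIndex_lt_two_mul.1 hlt).le⟩, ?_⟩
    rintro ⟨n, -, rfl⟩
    rw [regionIndex_natCast] at hodd
    omega

theorem residual_eq (h : A.Represents c y L) {t x : ℝ≥0} {r : ℕ}
    (hx : cappedIndex A.maxConst x = c.2) (hr : cappedIndex A.maxConst (x + (y + t)) = r) (a : α) :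
    residual L [(t, a)] =
      A.langFrom ((A.step c.1 a r).1, resetIf (A.step c.1 a r).2 (x + (y + t))) := by
  rw [h.lang_eq x hx, residual_langFrom, List.foldl_cons, List.foldl_nil, timedRead, read,
    ← hr, step_cappedIndex, add_assoc]

theorem exists_residual_eq (h : A.Represents c y L) (t : ℝ≥0) (a : α) :
    ∃ x, cappedIndex A.maxConst x = (A.regionRead c a (cappedIndex A.maxConst (y + t))).2 ∧
      residual L [(t, a)] =
        A.langFrom ((A.regionRead c a (cappedIndex A.maxConst (y + t))).1, x) := by
  obtain ⟨x, hx, hxt⟩ := exists_cappedIndex_add_eq h.snd_le (y + t)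
  exact ⟨_, by rw [cappedIndex_resetIf, hxt]; rfl, h.residual_eq hx hxt a⟩

theorem regionRead_of_resettable (h : A.Represents c y L) (hl : ∀ a, a ∈ l) {t : ℝ≥0} {a : α}
    (hres : A.Resettable l (A.regionRead c a (cappedIndex A.maxConst (y + t)))) :
    A.Represents (A.regionRead c a (cappedIndex A.maxConst (y + t))) 0 (residual L [(t, a)]) := by
  obtain ⟨x, hx, hL⟩ := h.exists_residual_eq t a
  have hmem := A.regionRead_fst_mem_states c a (cappedIndex A.maxConst (y + t))
  have hle := hx ▸ cappedIndex_le A.maxConst x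
  refine ⟨hmem, hle, .inl rfl, fun z hz => ?_⟩
  rw [hL, add_zero]
  exact (resettable_iff hl hmem hle).1 hres x z hx hz

theorem resettable_regionRead (h : A.Represents c y L) (hl : ∀ a, a ∈ l) {t : ℝ≥0} {a : α}
    (hrec : Recognizable (residual L [(t, a)])) :
    A.Resettable l (A.regionRead c a (cappedIndex A.maxConst (y + t))) := by
  obtain ⟨x, hx, hL⟩ := h.exists_residual_eq t a
  rw [← Prod.eta (A.regionRead c a (cappedIndex A.maxConst (y + t))), ← hx]
  exact resettable_of_recognizable hl (A.regionRead_fst_mem_states c a _) (hL ▸ hrec)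

theorem regionRead_of_not_resettable (h : A.Represents c y L) (hl : ∀ a, a ∈ l) {t : ℝ≥0} {a : α}
    (hres : ¬ A.Resettable l (A.regionRead c a (cappedIndex A.maxConst (y + t)))) :
    A.Represents ((A.regionRead c a (cappedIndex A.maxConst (y + t))).1, c.2) (y + t)
      (residual L [(t, a)]) := by
  obtain ⟨r, hr⟩ : ∃ r, cappedShiftIndex A.maxConst c.2 (cappedIndex A.maxConst (y + t)) = r :=
    ⟨_, rfl⟩
  have hle : r ≤ 2 * A.maxConst + 1 := hr ▸ min_le_right _ _
  have hmem := A.step_fst_mem_states c.1 a r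
  have hL : ∀ x, cappedIndex A.maxConst x = c.2 → cappedIndex A.maxConst (x + (y + t)) = r →
    _ := fun x hx hxt => h.residual_eq hx hxt a
  simp only [regionRead, hr] at hres ⊢
  cases hreset : (A.step c.1 a r).2
  case true =>
    exact absurd (resettable_of_even l _ (by rw [hreset, resetIf_true, Nat.zero_mod])) hres
  simp only [hreset, resetIf_false] at hres hL
  have heven : c.2 % 2 = 0 := by
    by_contra hodd
    obtain ⟨x, x', hlt, hx, hx', hxt, hxt'⟩ :=
      exists_lt_cappedIndex_add_eq (by omega) h.snd_le (y + t)
    rw [hr] at hxt hxt'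
    refine hres ((resettable_iff hl hmem hle).2 fun z z' =>
      langFrom_congr_of_cappedIndex_eq hxt hxt' (by gcongr) ?_)
    rw [← hL x hx hxt, hL x' hx' hxt']
  refine ⟨hmem, h.snd_le, .inr ⟨heven, ?_⟩, fun x hx => hL x hx ?_⟩
  · have hodd := odd_and_lt_of_not_resettable hl hmem hle hres
    rw [cappedShiftIndex, shiftIndex, if_pos heven, cappedIndex] at hr
    omega
  · rw [cappedIndex_add_of_even heven hx, hr]

theorem canonStep (h : A.Represents c y L) (hl : ∀ a, a ∈ l) (t : ℝ≥0) (a : α) :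
    A.Represents (A.canonStep l c a (cappedIndex A.maxConst (y + t))).1
      (resetIf (A.canonStep l c a (cappedIndex A.maxConst (y + t))).2 (y + t))
      (residual L [(t, a)]) := by
  unfold OneTA.canonStep
  split_ifs with hres
  exacts [h.regionRead_of_resettable hl hres, h.regionRead_of_not_resettable hl hres]

theorem exists_canon_run (h : A.Represents c y L) (hl : ∀ a, a ∈ l) (w : TimedWord α) :
    ∃ c' y', (canon l A).Run (Encodable.encode c) y w (Encodable.encode c') y' ∧
      A.Represents c' y' (residual L w) := by
  induction w generalizing c y L with
  | nil => exact ⟨c, y, .nil _ _, h⟩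
  | cons p w ih =>
    obtain ⟨c', y', hrun, hrep⟩ := ih (h.canonStep hl p.1 p.2)
    exact ⟨c', y', canon_run_cons hl h.fst_mem h.snd_le hrun, hrep⟩

theorem nil_mem_iff (h : A.Represents c y L) : [] ∈ L ↔ A.Accepting c.1 := by
  obtain ⟨x, hx, -⟩ := exists_cappedIndex_add_eq h.snd_le 0
  rw [h.lang_eq x hx]
  rfl

theorem langFrom_canon (h : A.Represents c y L) (hl : ∀ a, a ∈ l) :
    (canon l A).langFrom (some (Encodable.encode c), y) = L := by
  ext w
  obtain ⟨c', y', hrun, hrep⟩ := h.exists_canon_run hl w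
  rw [(canon_deterministic l A).run_iff] at hrun
  calc w ∈ (canon l A).langFrom (some (Encodable.encode c), y)
      ↔ (canon l A).Accepting (some (Encodable.encode c')) := by
        rw [langFrom, Set.mem_ofPred_eq, hrun]
    _ ↔ Encodable.encode c' ∈ (canon l A).final := by simp [Accepting]
    _ ↔ [] ∈ residual L w := by rw [encode_mem_canon_final hrep.snd_le, hrep.nil_mem_iff]
    _ ↔ w ∈ L := by rw [residual, Set.mem_ofPred_eq, List.append_nil]

theorem recognizable (h : A.Represents c 0 L) (hl : ∀ a, a ∈ l) : Recognizable L :=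
  ⟨{ canon l A with init := Encodable.encode c }, canon_deterministic l A,
    Deterministic.lang_eq_langFrom (A := { canon l A with init := Encodable.encode c })
      (canon_deterministic l A) |>.trans (h.langFrom_canon hl)⟩

open Classical in
theorem ite_recognizable_eq_resetIf (h : A.Represents c y L) (hl : ∀ a, a ∈ l) (t : ℝ≥0) (a : α) :
    (if Recognizable (residual L [(t, a)]) then 0 else y + t) =
      resetIf (A.canonStep l c a (cappedIndex A.maxConst (y + t))).2 (y + t) := by
  unfold OneTA.canonStep
  split_ifs with hrec hres hres
  · rfl
  · exact absurd (h.resettable_regionRead hl hrec) hres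
  · exact absurd ((h.regionRead_of_resettable hl hres).recognizable hl) hrec
  · rfl

theorem exists_canon_run_synResetFrom (h : A.Represents c y L) (hl : ∀ a, a ∈ l)
    (w : TimedWord α) : ∃ c',
      (canon l A).Run (Encodable.encode c) y w (Encodable.encode c') (synResetFrom L y w) ∧
      A.Represents c' (synResetFrom L y w) (residual L w) := by
  induction w generalizing c y L with
  | nil => exact ⟨c, .nil _ _, h⟩
  | cons p w ih =>
    obtain ⟨c', hrun, hrep⟩ := ih (h.canonStep hl p.1 p.2)
    rw [synResetFrom, h.ite_recognizable_eq_resetIf hl]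
    exact ⟨c', canon_run_cons hl h.fst_mem h.snd_le hrun, hrep⟩

end Represents

namespace Deterministic

theorem canon_lang (hA : A.Deterministic) (hl : ∀ a, a ∈ l) : (canon l A).lang = A.lang :=
  (canon_deterministic l A).lang_eq_langFrom.trans (hA.represents_init.langFrom_canon hl)

theorem canon_induces (hA : A.Deterministic) (hl : ∀ a, a ∈ l) :
    (canon l A).Induces (synReset A.lang) := fun u =>
  let ⟨_, hrun, _⟩ := hA.represents_init.exists_canon_run_synResetFrom hl u
  ⟨_, hrun⟩

end Deterministic

end OneTA

theorem OneTA.Deterministic.synReset_mem {α : Type*} {A : OneTA α} (hA : A.Deterministic)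
    {l : List α} (hl : ∀ a, a ∈ l) (u : TimedWord α) :
    synReset A.lang u ∈ Set.Icc (0 : ℝ≥0) (A.maxConst : ℝ≥0) \
      {x : ℝ≥0 | ∃ n : ℕ, 0 < n ∧ x = (n : ℝ≥0)} := by
  classical
  obtain ⟨_, -, hrep⟩ := hA.represents_init.exists_canon_run_synResetFrom hl u
  exact hrep.mem_Icc_diff

theorem Recognizable.exists_maxConst_eq {α : Type*} {L : Set (TimedWord α)} (h : Recognizable L) :
    ∃ A : OneTA α, A.Deterministic ∧ A.lang = L ∧ A.maxConst = minConst L :=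
  let ⟨A, hA, hL⟩ := h
  Nat.sInf_mem (s := {K | ∃ A : OneTA α, A.Deterministic ∧ A.lang = L ∧ A.maxConst = K})
    ⟨_, A, hA, hL, rfl⟩

section Computability

theorem primrec_atom_gt : Primrec Atom.gt :=
  (Primrec.of_equiv_symm (e := Atom.equivSum)).comp Primrec.sumInl

theorem primrec_atom_eq : Primrec Atom.eq :=
  (Primrec.of_equiv_symm (e := Atom.equivSum)).comp (Primrec.sumInr.comp Primrec.sumInl)

theorem primrec_atom_lt : Primrec Atom.lt :=
  (Primrec.of_equiv_symm (e := Atom.equivSum)).comp (Primrec.sumInr.comp Primrec.sumInr)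

theorem primrec_atom_casesOn {β σ : Type*} [Primcodable β] [Primcodable σ] {c : β → Atom}
    {f g h : β → ℕ → σ} (hc : Primrec c) (hf : Primrec₂ f) (hg : Primrec₂ g) (hh : Primrec₂ h) :
    Primrec fun b => (Atom.casesOn (c b) (f b) (g b) (h b) : σ) := by
  have hrest : Primrec₂ fun (b : β) (s : ℕ ⊕ ℕ) => (Sum.casesOn s (g b) (h b) : σ) :=
    Primrec.sumCasesOn Primrec.snd (hg.comp₂ (Primrec.fst.comp Primrec.fst).to₂ Primrec₂.right)
      (hh.comp₂ (Primrec.fst.comp Primrec.fst).to₂ Primrec₂.right)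
  refine (Primrec.sumCasesOn ((Primrec.of_equiv (e := Atom.equivSum)).comp hc) hf hrest).of_eq
    fun b => ?_
  cases c b <;> rfl

theorem primrec_atom_const : Primrec Atom.const :=
  (primrec_atom_casesOn .id Primrec₂.right Primrec₂.right Primrec₂.right).of_eq fun c => by
    cases c <;> rfl

theorem primrecRel_atom_sat : PrimrecRel fun c r => Atom.sat c r = true := by
  have hr : Primrec₂ fun (p : Atom × ℕ) (_ : ℕ) => p.2 := (Primrec.snd.comp Primrec.fst).to₂
  have hc : Primrec₂ fun (_ : Atom × ℕ) (c : ℕ) => 2 * c :=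
    (Primrec.nat_mul.comp (.const 2) .snd).to₂
  refine Primrec.eq.comp ((primrec_atom_casesOn .fst (Primrec.nat_lt.decide.comp₂ hc hr)
    (Primrec.eq.decide.comp₂ hr hc) (Primrec.nat_lt.decide.comp₂ hr hc)).of_eq fun p => ?_)
    (.const true)
  cases p.1 <;> rfl

theorem primrec_guard_atoms : Primrec Guard.atoms :=
  Primrec.list_cons.comp .fst .snd

theorem primrecRel_guard_sat : PrimrecRel fun g r => Guard.sat g r = true :=
  (primrecRel_atom_sat.forall_mem_list.comp (primrec_guard_atoms.comp .fst) .snd).of_eq fun p => by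
    simp only [Guard.sat, List.all_eq_true]

variable {γ : Type*} [Primcodable γ] {n n' K r s : γ → ℕ} {b b' : γ → Bool}

theorem primrecPred_mod_two_eq_zero (hn : Primrec n) : PrimrecPred fun c => n c % 2 = 0 :=
  Primrec.eq.comp (Primrec.nat_mod.comp hn (.const 2)) (.const 0)

theorem primrec_lastIndex (hK : Primrec K) : Primrec fun c => 2 * K c + 1 :=
  Primrec.succ.comp (Primrec.nat_mul.comp (.const 2) hK)

theorem primrec_regionGuard (hK : Primrec K) (hs : Primrec s) :
    Primrec fun c => regionGuard (K c) (s c) := by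
  have hhalf : Primrec fun c => s c / 2 := Primrec.nat_div.comp hs (.const 2)
  have hgt := primrec_atom_gt.comp hhalf
  have hlt := primrec_atom_lt.comp (Primrec.succ.comp hhalf)
  exact .ite (primrecPred_mod_two_eq_zero hs) (.pair (primrec_atom_eq.comp hhalf) (.const []))
    (.ite (Primrec.nat_lt.comp hs (primrec_lastIndex hK))
      (.pair hgt (Primrec.list_cons.comp hlt (.const []))) (.pair hgt (.const [])))

theorem primrec_resetIf (hb : Primrec b) (hn : Primrec n) :
    Primrec fun c => resetIf (b c) (n c) :=
  .cond hb (.const 0) hn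

theorem primrec_cappedShiftIndex (hK : Primrec K) (hr : Primrec r) (hs : Primrec s) :
    Primrec fun c => cappedShiftIndex (K c) (r c) (s c) :=
  Primrec.nat_min.comp (Primrec.nat_add.comp hr (.ite (primrecPred_mod_two_eq_zero hr) hs
    (Primrec.nat_mul.comp (.const 2) (Primrec.nat_div.comp hs (.const 2))))) (primrec_lastIndex hK)

theorem primrec_quarterIndex (hn : Primrec n) : Primrec fun c => quarterIndex (n c) :=
  Primrec.nat_add.comp (Primrec.nat_div.comp hn (.const 4))
    (Primrec.nat_div.comp (Primrec.nat_add.comp hn (.const 3)) (.const 4))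

theorem primrec_capQuarters (hK : Primrec K) (hn : Primrec n) :
    Primrec fun c => capQuarters (K c) (n c) :=
  .ite (Primrec.nat_lt.comp hn (Primrec.nat_mul.comp (.const 4)
      (Primrec.nat_add.comp hK (.const 2)))) hn
    (Primrec.nat_add.comp (Primrec.nat_mul.comp (.const 4) (Primrec.succ.comp hK))
      (Primrec.nat_mod.comp hn (.const 4)))

theorem primrec_quarterReset (hb : Primrec b) (hb' : Primrec b') (hn : Primrec n) :
    Primrec fun c => quarterReset (b c) (b' c) (n c) :=
  .cond hb (.const 0)
    (.cond hb' (Primrec.nat_mul.comp (.const 2) (primrec_quarterIndex hn)) hn)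

theorem primrec_reachableUpTo {β : Type*} [Primcodable β] {succ : γ → β → List β} {c : γ → β}
    (hsucc : Primrec₂ succ) (hn : Primrec n) (hc : Primrec c) :
    Primrec fun x => reachableUpTo (succ x) (n x) (c x) :=
  .nat_iterate hn (Primrec.list_cons.comp hc (.const [])) (Primrec.list_append.comp .snd
    (.list_flatMap .snd (hsucc.comp (Primrec.fst.comp .fst) .snd)))

variable {α : Type*} [Primcodable α]

theorem primrec_transition_equiv : Primrec (Transition.equivProd α) := .of_equiv

theorem primrec_src : Primrec (Transition.src (α := α)) :=
  Primrec.fst.comp primrec_transition_equiv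

theorem primrec_tgt : Primrec (Transition.tgt (α := α)) :=
  Primrec.fst.comp (Primrec.snd.comp primrec_transition_equiv)

theorem primrec_letter : Primrec (Transition.letter (α := α)) :=
  Primrec.fst.comp (Primrec.snd.comp (Primrec.snd.comp primrec_transition_equiv))

theorem primrec_guard : Primrec (Transition.guard (α := α)) :=
  Primrec.fst.comp (Primrec.snd.comp (Primrec.snd.comp (Primrec.snd.comp primrec_transition_equiv)))

theorem primrec_reset : Primrec (Transition.reset (α := α)) :=
  Primrec.snd.comp (Primrec.snd.comp (Primrec.snd.comp (Primrec.snd.comp primrec_transition_equiv)))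

theorem primrec_transition_mk {src tgt : γ → ℕ} {letter : γ → α} {guard : γ → Guard}
    {reset : γ → Bool} (hsrc : Primrec src) (htgt : Primrec tgt) (hletter : Primrec letter)
    (hguard : Primrec guard) (hreset : Primrec reset) :
    Primrec fun c => Transition.mk (src c) (tgt c) (letter c) (guard c) (reset c) :=
  (Primrec.of_equiv_symm (e := Transition.equivProd α)).comp
    (hsrc.pair (htgt.pair (hletter.pair (hguard.pair hreset))))

namespace OneTA

theorem primrec_init : Primrec (OneTA.init (α := α)) :=
  Primrec.fst.comp (.of_equiv (e := OneTA.equivProd α))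

theorem primrec_trans : Primrec (OneTA.trans (α := α)) :=
  Primrec.fst.comp (Primrec.snd.comp (.of_equiv (e := OneTA.equivProd α)))

theorem primrec_final : Primrec (OneTA.final (α := α)) :=
  Primrec.snd.comp (Primrec.snd.comp (.of_equiv (e := OneTA.equivProd α)))

theorem primrec_mk {init : γ → ℕ} {trans : γ → List (Transition α)} {final : γ → List ℕ}
    (hinit : Primrec init) (htrans : Primrec trans) (hfinal : Primrec final) :
    Primrec fun c => OneTA.mk (init c) (trans c) (final c) :=
  (Primrec.of_equiv_symm (e := OneTA.equivProd α)).comp (hinit.pair (htrans.pair hfinal))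

theorem primrec_maxConst : Primrec (maxConst (α := α)) := by
  have hconstants : Primrec (constants (α := α)) :=
    .list_flatMap primrec_trans (.list_map (primrec_guard_atoms.comp (primrec_guard.comp .snd))
      (primrec_atom_const.comp .snd).to₂)
  exact .list_foldr hconstants (.const 0)
    (Primrec.nat_max.comp (Primrec.fst.comp .snd) (Primrec.snd.comp .snd)).to₂

theorem primrec_states : Primrec (states (α := α)) :=
  Primrec.list_cons.comp (.const none) (Primrec.list_cons.comp
    (Primrec.option_some.comp primrec_init)
    (.list_map primrec_trans (Primrec.option_some.comp (primrec_tgt.comp .snd)).to₂))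

theorem primrecRel_accepting : PrimrecRel (Accepting (α := α)) :=
  have hsome : PrimrecRel fun (f : ℕ) (q : Option ℕ) => some f = q :=
    Primrec.eq.comp (Primrec.option_some.comp .fst) .snd
  hsome.exists_mem_list.comp (primrec_final.comp .fst) .snd

theorem primrec_range_maxConst : Primrec fun A : OneTA α => List.range (2 * A.maxConst + 2) :=
  Primrec.list_range.comp (Primrec.succ.comp (primrec_lastIndex primrec_maxConst))

theorem primrec_quarterBound : Primrec fun A : OneTA α => 4 * (A.maxConst + 2) :=
  Primrec.nat_mul.comp (.const 4) (Primrec.nat_add.comp primrec_maxConst (.const 2))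

variable [DecidableEq α] {A : γ → OneTA α} {q : γ → Option ℕ} {a : γ → α} {l : List α}

theorem primrec_enabled (hA : Primrec A) (hq : Primrec q) (ha : Primrec a) (hr : Primrec r) :
    Primrec fun c => (A c).enabled (q c) (a c) (r c) := by
  have henabled : PrimrecRel fun (θ : Transition α) (d : Option ℕ × α × ℕ) =>
      some θ.src = d.1 ∧ θ.letter = d.2.1 ∧ Guard.sat θ.guard d.2.2 :=
    (Primrec.eq.comp (Primrec.option_some.comp (primrec_src.comp .fst))
      (Primrec.fst.comp .snd)).and ((Primrec.eq.comp (primrec_letter.comp .fst)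
        (Primrec.fst.comp (Primrec.snd.comp .snd))).and (primrecRel_guard_sat.comp
          (primrec_guard.comp .fst) (Primrec.snd.comp (Primrec.snd.comp .snd))))
  simp only [enabled, ← List.head?_filter]
  exact Primrec.list_head?.comp
    (henabled.listFilter.comp (primrec_trans.comp hA) (hq.pair (ha.pair hr)))

theorem primrec_step (hA : Primrec A) (hq : Primrec q) (ha : Primrec a) (hr : Primrec r) :
    Primrec fun c => (A c).step (q c) (a c) (r c) :=
  Primrec.option_getD.comp (.option_map (primrec_enabled hA hq ha hr)
    ((Primrec.option_some.comp (primrec_tgt.comp .snd)).pair (primrec_reset.comp .snd)).to₂)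
    (.const (none, true))

theorem primrec_quarterStep {c : γ → QuarterConfig × QuarterConfig} (hA : Primrec A)
    (hn : Primrec n) (ha : Primrec a) (hc : Primrec c) :
    Primrec fun x => (A x).quarterStep (n x) (a x) (c x) := by
  have hfst := Primrec.fst.comp hc
  have hsnd := Primrec.snd.comp hc
  have hcap : ∀ {f : γ → QuarterConfig}, Primrec f → Primrec fun x =>
      capQuarters (A x).maxConst ((f x).2 + n x) := fun hf =>
    primrec_capQuarters (primrec_maxConst.comp hA) (Primrec.nat_add.comp (Primrec.snd.comp hf) hn)
  have hstep := primrec_step hA (Primrec.fst.comp hfst) ha (primrec_quarterIndex (hcap hfst))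
  have hstep' := primrec_step hA (Primrec.fst.comp hsnd) ha (primrec_quarterIndex (hcap hsnd))
  have hb := Primrec.snd.comp hstep
  have hb' := Primrec.snd.comp hstep'
  exact .pair (.pair (Primrec.fst.comp hstep) (primrec_quarterReset hb hb' (hcap hfst)))
    (.pair (Primrec.fst.comp hstep') (primrec_quarterReset hb' hb (hcap hsnd)))

theorem primrec_quarterSucc {c : γ → QuarterConfig × QuarterConfig} (hA : Primrec A)
    (hc : Primrec c) : Primrec fun x => (A x).quarterSucc l (c x) :=
  .list_flatMap (Primrec.list_range.comp (primrec_quarterBound.comp hA))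
    (.list_map (.const l) (primrec_quarterStep (hA.comp (Primrec.fst.comp .fst))
      (Primrec.snd.comp .fst) .snd (hc.comp (Primrec.fst.comp .fst))))

theorem primrec_reachableQuarters {c : γ → QuarterConfig × QuarterConfig} (hA : Primrec A)
    (hc : Primrec c) : Primrec fun x => (A x).reachableQuarters l (c x) := by
  have hbound : Primrec fun x => (A x).states.length * (4 * ((A x).maxConst + 2)) :=
    Primrec.nat_mul.comp (Primrec.list_length.comp (primrec_states.comp hA))
      (primrec_quarterBound.comp hA)
  simp only [reachableQuarters, sq]
  exact primrec_reachableUpTo (primrec_quarterSucc (hA.comp .fst) .snd)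
    (Primrec.nat_mul.comp hbound hbound) hc

theorem primrecPred_resettable {c : γ → Option ℕ × ℕ} (hA : Primrec A) (hc : Primrec c) :
    PrimrecPred fun x => (A x).Resettable l (c x) := by
  have hq := Primrec.fst.comp hc
  have hr := Primrec.snd.comp hc
  have htwo := Primrec.nat_mul.comp (.const 2) hr
  have hagree : PrimrecRel fun (d : QuarterConfig × QuarterConfig) (A : OneTA α) =>
      (A.Accepting d.1.1 ↔ A.Accepting d.2.1) := by
    have hacc := (primrecRel_accepting (α := α)).comp .snd (Primrec.fst.comp
      (Primrec.fst.comp (.fst (α := QuarterConfig × QuarterConfig))))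
    have hacc' := (primrecRel_accepting (α := α)).comp .snd (Primrec.fst.comp
      (Primrec.snd.comp (.fst (α := QuarterConfig × QuarterConfig))))
    exact (Primrec.eq.comp hacc.decide hacc'.decide).of_eq fun _ => decide_eq_decide
  exact (primrecPred_mod_two_eq_zero hr).or (hagree.forall_mem_list.comp
    (primrec_reachableQuarters hA (.pair (.pair hq (Primrec.nat_sub.comp htwo (.const 1)))
      (.pair hq (Primrec.succ.comp htwo)))) hA)

theorem primrec_regionRead {c : γ → Option ℕ × ℕ} (hA : Primrec A) (hc : Primrec c)
    (ha : Primrec a) (hs : Primrec s) : Primrec fun x => (A x).regionRead (c x) (a x) (s x) := by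
  have hr := primrec_cappedShiftIndex (primrec_maxConst.comp hA) (Primrec.snd.comp hc) hs
  have hstep := primrec_step hA (Primrec.fst.comp hc) ha hr
  exact .pair (Primrec.fst.comp hstep) (primrec_resetIf (Primrec.snd.comp hstep) hr)

theorem primrec_canonStep {c : γ → Option ℕ × ℕ} (hA : Primrec A) (hc : Primrec c)
    (ha : Primrec a) (hs : Primrec s) : Primrec fun x => (A x).canonStep l (c x) (a x) (s x) := by
  have hread := primrec_regionRead hA hc ha hs
  exact .ite (primrecPred_resettable hA hread) (.pair hread (.const true))
    (.pair (.pair (Primrec.fst.comp hread) (Primrec.snd.comp hc)) (.const false))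

theorem primrec_canonTransition {c : γ → Option ℕ × ℕ} (hA : Primrec A) (hc : Primrec c)
    (ha : Primrec a) (hs : Primrec s) :
    Primrec fun x => (A x).canonTransition l (c x) (a x) (s x) := by
  have hstep := primrec_canonStep (l := l) hA hc ha hs
  exact primrec_transition_mk (Primrec.encode.comp hc)
    (Primrec.encode.comp (Primrec.fst.comp hstep)) ha
    (primrec_regionGuard (primrec_maxConst.comp hA) hs) (Primrec.snd.comp hstep)

theorem primrec_canon (l : List α) : Primrec (canon l) := by
  have htrans : Primrec fun x : ((OneTA α × Option ℕ) × ℕ) × α =>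
      (List.range (2 * x.1.1.1.maxConst + 2)).map fun s =>
        x.1.1.1.canonTransition l (x.1.1.2, x.1.2) x.2 s := by
    have hd : Primrec fun y : (((OneTA α × Option ℕ) × ℕ) × α) × ℕ => y.1.1.1 :=
      Primrec.fst.comp (Primrec.fst.comp .fst)
    exact .list_map (primrec_range_maxConst.comp (Primrec.fst.comp (Primrec.fst.comp .fst)))
      (primrec_canonTransition (Primrec.fst.comp hd)
        (.pair (Primrec.snd.comp hd) (Primrec.snd.comp (Primrec.fst.comp .fst)))
        (Primrec.snd.comp .fst) .snd)
  exact primrec_mk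
    (Primrec.encode.comp (.pair (Primrec.option_some.comp primrec_init) (.const 0)))
    (.list_flatMap primrec_states (.list_flatMap (primrec_range_maxConst.comp .fst)
      (.list_flatMap (.const l) htrans)))
    (.list_flatMap primrec_final (.list_map (primrec_range_maxConst.comp .fst)
      (Primrec.encode.comp (.pair (Primrec.option_some.comp (Primrec.snd.comp .fst)) .snd))))

end OneTA

end Computability

end OneClock

theorem theorem1 {α : Type*} [Finite α] [Primcodable α] :
    (∃ f : OneClock.OneTA α → OneClock.OneTA α, Computable f ∧
      ∀ A : OneClock.OneTA α, A.Deterministic →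
        (f A).Deterministic ∧ (f A).Complete ∧ (f A).RegionGuarded ∧
        (f A).lang = A.lang ∧
        (f A).maxConst = A.maxConst ∧
        (f A).Induces (OneClock.synReset A.lang)) ∧
    (∀ L : Set (OneClock.TimedWord α), OneClock.Recognizable L →
      ∀ u : OneClock.TimedWord α,
        OneClock.synReset L u ∈
          Set.Icc (0 : NNReal) (OneClock.minConst L : NNReal) \
            {x : NNReal | ∃ n : ℕ, 0 < n ∧ x = (n : NNReal)}) := by
  classical
  have := Fintype.ofFinite α
  obtain ⟨l, hl⟩ : ∃ l : List α, ∀ a, a ∈ l := ⟨Finset.univ.toList, by simp⟩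
  refine ⟨⟨OneClock.OneTA.canon l, (OneClock.OneTA.primrec_canon l).to_comp, fun A hA => ?_⟩,
    fun L hL u => ?_⟩
  · have hinduces := hA.canon_induces hl
    exact ⟨OneClock.OneTA.canon_deterministic l A, hinduces.complete,
      OneClock.OneTA.canon_regionGuarded hl A, hA.canon_lang hl, OneClock.OneTA.canon_maxConst hl A,
      hinduces⟩
  · obtain ⟨A, hA, rfl, hK⟩ := hL.exists_maxConst_eq
    rw [← hK]
    exact hA.synReset_mem hl u
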